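/- Let $n\in\mathbb R$, $n\neq 0,1$. Consider the class of equations $$u_t+u^nu_x+\beta(t)u_{xxxxx}=0,\qquad (*)$$ where $\beta$ is a smooth nonvanishing function on an open interval $J$, and $(t,x,u)$ ranges over a box $D=J\times X\times U$ of nonempty open intervals such that $u^n$ is a smooth function on $U$ (that is, $U\subseteq(0,\infty)$, or $n$ is an integer and $0\notin U$, or $n$ is a positive integer). The maximal Lie invariance algebra $A^{\max}$ of $(*)$ in $D$ is the set of all smooth vector fields $Q=\tau(t,x,u)\partial_t+\xi(t,x,u)\partial_x+\eta(t,x,u)\partial_u$ on $D$ whose fifth prolongation $Q^{(5)}$ satisfies $Q^{(5)}\{u_t+u^nu_x+\beta u_{xxxxx}\}=0$ at all jets over $D$ that satisfy $(*)$. The kernel $A^{\ker}$ is the intersection of the algebras $A^{\max}$ for all smooth nonvanishing $\beta$ on $J$ (with $n$ and $D$ fixed). Let $G^\sim_0$ be the group of the transformations $$\tilde t=\delta_3t+\delta_4,\quad \tilde x=\delta_1x+\delta_2,\quad \tilde u=(\delta_1/\delta_3)^{1/n}u,\quad \tilde\beta(\tilde t)=\frac{\delta_1^5}{\delta_3}\beta(t),\quad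 \tilde n=n,$$ with real constants $\delta_1,\dots,\delta_4$, $\delta_1\delta_3>0$, which act on the equations together with their domains. Then: (1) $A^{\ker}=\langle\partial_x\rangle$, and it is one-dimensional. (2) $A^{\max}\neq A^{\ker}$ for an equation of the class if and only if the equation is $G^\sim_0$-equivalent to one with $\beta=\varepsilon t^\rho$ ($t>0$, $\rho\neq0$), $\beta=\varepsilon e^t$ or $\beta=\varepsilon$, where $\varepsilon=\pm1$. Canonical forms of different types, or with different values of $\rho$ or $\varepsilon$, are not $G^\sim_0$-equivalent. (3) For every constant $\varepsilon\neq0$ the following vector fields form a basis of $A^{\max}$: - for $\beta=\varepsilon t^\rho$, $\rho\neq0$ (where $t>0$, or $t\ne0$ on $J$ and $\rho$ is an integer): $\ \partial_x,\ \ 5nt\partial_t+(\rho+1)nx\partial_x+(\rho-4)u\partial_u$; - for $\beta=\varepsilon e^t$: $\ \partial_x,\ \ 5n\partial_t+nx\partial_x+u\partial_u$; - for $\beta=\varepsilon$: $\ \partial_x,\ \ \partial_t,\ \ 5nt\partial_t+nx\partial_x-4u\partial_u$. -/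

import Mathlib

open Set
open scoped ContDiff

noncomputable section

/-- The power `s ↦ s ^ a` with real exponent `a` is a well-defined, smooth real function on the
open set `S`: either `S` consists of positive numbers, or `a` is an integer and `0 ∉ S`, or `a` is a
nonnegative integer. (In all these cases `Real.rpow` is the usual power.) -/
def PowDefined (a : ℝ) (S : Set ℝ) : Prop :=
  S ⊆ Ioi 0 ∨ ((∃ k : ℤ, a = k) ∧ (0 : ℝ) ∉ S) ∨ ∃ k : ℕ, a = k

/-- A domain of the variables `(t, x, u)`: a product of three nonempty open intervals (bounded or
not) of the real line. -/
structure Box where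
  J : Set ℝ
  X : Set ℝ
  U : Set ℝ
  isOpen_J : IsOpen J
  isOpen_X : IsOpen X
  isOpen_U : IsOpen U
  nonempty_J : J.Nonempty
  nonempty_X : X.Nonempty
  nonempty_U : U.Nonempty
  ordConnected_J : J.OrdConnected
  ordConnected_X : X.OrdConnected
  ordConnected_U : U.OrdConnected

/-- The set of points `(t, x, u)` of the box. -/
def Box.toSet (D : Box) : Set (ℝ × ℝ × ℝ) := D.J ×ˢ D.X ×ˢ D.U

/-- The coefficients `β` of the class: smooth nonvanishing functions of `t ∈ J`. -/
def IsCoefficient (J : Set ℝ) (β : ℝ → ℝ) : Prop :=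
  ContDiffOn ℝ ∞ β J ∧ ∀ t ∈ J, β t ≠ 0

/-! ### Jets, total derivatives and prolongations -/

/-- Jets of functions `u(t, x)`: the point `(t, x, v)` has the independent variables `t` and `x`, and
`v (i, j)` is the jet coordinate of the derivative `∂ⁱ⁺ʲ u / ∂tⁱ ∂xʲ`. -/
abbrev Jet : Type := ℝ × ℝ × (ℕ × ℕ → ℝ)

/-- The projection of a jet to the space of the variables `(t, x, u)`. -/
def Jet.base (p : Jet) : ℝ × ℝ × ℝ := (p.1, p.2.1, p.2.2 (0, 0))

/-- The total derivative `D_t = ∂_t + ∑ u_{i+1,j} ∂_{u_{i,j}}`, as the derivative of `F` at the jet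
`p` in the direction with the coefficients of `D_t` at `p`. -/
def totalDt (F : Jet → ℝ) (p : Jet) : ℝ :=
  lineDeriv ℝ F p (1, 0, fun m => p.2.2 (m.1 + 1, m.2))

/-- The total derivative `D_x = ∂_x + ∑ u_{i,j+1} ∂_{u_{i,j}}`. -/
def totalDx (F : Jet → ℝ) (p : Jet) : ℝ :=
  lineDeriv ℝ F p (0, 1, fun m => p.2.2 (m.1, m.2 + 1))

/-- A vector field `τ ∂_t + ξ ∂_x + η ∂_u` is the function
`(t, x, u) ↦ (τ (t, x, u), ξ (t, x, u), η (t, x, u))`. -/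
abbrev VField : Type := ℝ × ℝ × ℝ → ℝ × ℝ × ℝ

/-- The component `τ` as a function of jets. -/
def VField.tau (Q : VField) (p : Jet) : ℝ := (Q p.base).1

/-- The component `ξ` as a function of jets. -/
def VField.xi (Q : VField) (p : Jet) : ℝ := (Q p.base).2.1

/-- The component `η` as a function of jets. -/
def VField.eta (Q : VField) (p : Jet) : ℝ := (Q p.base).2.2

/-- The coefficients `η^{(i,0)}` of the prolongation of `Q`:
`η^{(0,0)} = η` and `η^{(i+1,0)} = D_t η^{(i,0)} - u_{i+1,0} D_t τ - u_{i,1} D_t ξ`. -/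
def VField.prolongCoeffT (Q : VField) : ℕ → Jet → ℝ
  | 0 => Q.eta
  | i + 1 => fun p => totalDt (Q.prolongCoeffT i) p
      - p.2.2 (i + 1, 0) * totalDt Q.tau p - p.2.2 (i, 1) * totalDt Q.xi p

/-- The coefficients `η^{(i,j)}` of the prolongation of `Q`:
`η^{(i,j+1)} = D_x η^{(i,j)} - u_{i+1,j} D_x τ - u_{i,j+1} D_x ξ`. -/
def VField.prolongCoeff (Q : VField) (i : ℕ) : ℕ → Jet → ℝ
  | 0 => Q.prolongCoeffT i
  | j + 1 => fun p => totalDx (Q.prolongCoeff i j) p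
      - p.2.2 (i + 1, j) * totalDx Q.tau p - p.2.2 (i, j + 1) * totalDx Q.xi p

/-- The value at the jet `p` of the prolongation of order `r`,
`Q^{(r)} = τ ∂_t + ξ ∂_x + ∑_{i + j ≤ r} η^{(i,j)} ∂_{u_{i,j}}`, applied to the function `F`. -/
def VField.prolong (r : ℕ) (Q : VField) (F : Jet → ℝ) (p : Jet) : ℝ :=
  lineDeriv ℝ F p
    (Q.tau p, Q.xi p, fun m => if m.1 + m.2 ≤ r then Q.prolongCoeff m.1 m.2 p else 0)

/-! ### The class of equations and its Lie invariance algebras -/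

/-- The left-hand side of the equation `u_t + u ^ n u_x + β(t) u_{xxxxx} = 0`. -/
def fkdv (n : ℝ) (β : ℝ → ℝ) (p : Jet) : ℝ :=
  p.2.2 (1, 0) + p.2.2 (0, 0) ^ n * p.2.2 (0, 1) + β p.1 * p.2.2 (0, 5)

/-- The maximal Lie invariance algebra `A^max` of the equation `u_t + u ^ n u_x + β(t) u_{xxxxx} = 0`
in the box `D`: the smooth vector fields `Q` on `D` with `Q^{(5)} (u_t + u ^ n u_x + β u_{xxxxx}) = 0`
at all jets over `D` that satisfy the equation. A vector field on `D` is
represented by the function on the whole space that vanishes outside `D`. -/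
def maxAlgebra (n : ℝ) (D : Box) (β : ℝ → ℝ) : Set VField :=
  {Q | ContDiffOn ℝ ∞ Q D.toSet ∧ (∀ z ∉ D.toSet, Q z = 0) ∧
    ∀ p : Jet, p.base ∈ D.toSet → fkdv n β p = 0 → Q.prolong 5 (fkdv n β) p = 0}

/-- The kernel `A^ker`: the vector fields in the maximal Lie invariance algebras of all the
equations of the class (with the given `n`, in the given box). -/
def kernelAlgebra (n : ℝ) (D : Box) : Set VField :=
  {Q | ∀ β : ℝ → ℝ, IsCoefficient D.J β → Q ∈ maxAlgebra n D β}

/-- The vector field `τ ∂_t + ξ ∂_x + η ∂_u` on `D` with the components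
`(τ, ξ, η) = f t x u`. -/
def Box.field (D : Box) (f : ℝ → ℝ → ℝ → ℝ × ℝ × ℝ) : VField :=
  D.toSet.indicator fun z => f z.1 z.2.1 z.2.2

/-- The set `A` of vector fields is a real vector space with basis `b`. -/
def IsBasisOf {k : ℕ} (b : Fin k → VField) (A : Set VField) : Prop :=
  LinearIndependent ℝ b ∧ A = (Submodule.span ℝ (range b) : Set VField)

/-! ### Equivalence -/

/-- The parameters of the transformations of the equivalence group. -/
structure EquivTransf where
  δ₁ : ℝ
  δ₂ : ℝ
  δ₃ : ℝ
  δ₄ : ℝ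
  pos : 0 < δ₁ * δ₃

/-- The point transformation `(t, x, u) ↦ (δ₃ t + δ₄, δ₁ x + δ₂, (δ₁ / δ₃) ^ (1 / n) u)`. -/
def EquivTransf.map (g : EquivTransf) (n : ℝ) (z : ℝ × ℝ × ℝ) : ℝ × ℝ × ℝ :=
  (g.δ₃ * z.1 + g.δ₄, g.δ₁ * z.2.1 + g.δ₂, (g.δ₁ / g.δ₃) ^ (1 / n) * z.2.2)

/-- Some transformation of the equivalence group maps the equation with the
coefficient `β` in the box `D` to the equation with the coefficient `β'` in the box `D'`. -/
def Equivalent (n : ℝ) (D : Box) (β : ℝ → ℝ) (D' : Box) (β' : ℝ → ℝ) : Prop :=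
  ∃ g : EquivTransf, g.map n '' D.toSet = D'.toSet ∧
    ∀ t ∈ D.J, β' (g.δ₃ * t + g.δ₄) = g.δ₁ ^ 5 / g.δ₃ * β t

/-- The three types of coefficients: `ε t ^ ρ`, `ε e ^ t` and `ε`. -/
inductive ExtCase where
  | power (ρ : ℝ)
  | exponential
  | constant

/-- The function `t ^ ρ`, `e ^ t` or `1`. -/
def ExtCase.profile : ExtCase → ℝ → ℝ
  | .power ρ, t => t ^ ρ
  | .exponential, t => Real.exp t
  | .constant, _ => 1

/-- The coefficient `β` is on `J` one of the canonical forms `ε t ^ ρ` (`ρ ≠ 0`, `t > 0`), `ε e ^ t`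
and `ε`, where `ε = ±1`. -/
def IsCanonical (c : ExtCase) (ε : ℝ) (J : Set ℝ) (β : ℝ → ℝ) : Prop :=
  (ε = 1 ∨ ε = -1) ∧ (∀ ρ : ℝ, c = .power ρ → ρ ≠ 0 ∧ J ⊆ Ioi 0) ∧
    ∀ t ∈ J, β t = ε * c.profile t

end

/-! The invariance condition is polynomial in the jet coordinates left free once `u_t` is eliminated
through the equation, so its coefficients vanish separately. The mixed derivative `u_{txxxx}` forces
`τ = τ(t)`; the coefficient of `u_5` gives `ξ_u = 0` and the classifying relation `5βξ_x = β'τ +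
βτ_t`, hence `ξ_xx = 0`; the coefficient of `u_4` makes `η` affine in `u` with `η_xu = 0`. What
remains contains `u^n (τ_t - ξ_x) + n u^(n-1) η - ξ_t = 0`. For `n ≠ 0, 1` the powers of `u`
separate, so `η = e u`, `ξ_t = 0` and `τ_t - ξ_x + n e = 0`. For `n = 1` this separation breaks
down, since a constant term of `η` can balance `ξ_t`.

Hence (`mem_maxAlgebra_iff`) `A^max` consists of the fields `(a t + b)∂_t + (c₁ x + c₀)∂_x + e u
∂_u` with `a - c₁ + n e = 0` and `(a t + b) β' = (5 c₁ - a) β`. The rest is linear algebra and one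
first-order ODE. The coefficients `1` and `exp` already cut the kernel down to `⟨∂_x⟩`. Any `a, b,
μ` with `(a t + b) β' = μ β` determine `c₁` and `e`, so the kernel is extended exactly when such a
relation holds with `(a, b) ≠ 0` (`maxAlgebra_ne_kernelAlgebra_iff`). Its nonvanishing solutions are
constants, exponentials and powers of an affine function of `t` (`exists_profile_iff`), and `G^∼_0`
normalizes the affine function and the constant factor (`exists_equivalent_canonical_iff`).
Inequivalence of the canonical forms (`canonical_unique`) follows by comparing signs and logarithmic
derivatives. -/

noncomputable section

/-! ### Directional derivatives on a box -/

lemma Box.isOpen_toSet (D : Box) : IsOpen D.toSet :=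
  D.isOpen_J.prod (D.isOpen_X.prod D.isOpen_U)

lemma Box.convex_toSet (D : Box) : Convex ℝ D.toSet :=
  D.ordConnected_J.convex.prod (D.ordConnected_X.convex.prod D.ordConnected_U.convex)

/-- Smooth real functions on the box. -/
def Box.Smooth (D : Box) (f : ℝ × ℝ × ℝ → ℝ) : Prop := ContDiffOn ℝ ∞ f D.toSet

/-- The derivative of `f` in the direction `v`, as a function of the point. -/
def dirDeriv (v : ℝ × ℝ × ℝ) (f : ℝ × ℝ × ℝ → ℝ) (z : ℝ × ℝ × ℝ) : ℝ := fderiv ℝ f z v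

/-- The partial derivative with respect to `t`. -/
abbrev pdt : (ℝ × ℝ × ℝ → ℝ) → ℝ × ℝ × ℝ → ℝ := dirDeriv (1, 0, 0)

/-- The partial derivative with respect to `x`. -/
abbrev pdx : (ℝ × ℝ × ℝ → ℝ) → ℝ × ℝ × ℝ → ℝ := dirDeriv (0, 1, 0)

/-- The partial derivative with respect to `u`. -/
abbrev pdu : (ℝ × ℝ × ℝ → ℝ) → ℝ × ℝ × ℝ → ℝ := dirDeriv (0, 0, 1)

section
variable {D : Box} {f g : ℝ × ℝ × ℝ → ℝ} {z : ℝ × ℝ × ℝ}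

lemma Box.Smooth.dirDeriv (hf : D.Smooth f) (v : ℝ × ℝ × ℝ) : D.Smooth (dirDeriv v f) :=
  (hf.fderiv_of_isOpen D.isOpen_toSet (m := ∞) (by simp)).clm_apply contDiffOn_const

lemma Box.Smooth.iterate (hf : D.Smooth f) (v : ℝ × ℝ × ℝ) (k : ℕ) :
    D.Smooth ((_root_.dirDeriv v)^[k] f) := by
  induction k with
  | zero => exact hf
  | succ k ih => rw [Function.iterate_succ_apply']; exact ih.dirDeriv v

lemma Box.Smooth.differentiableAt (hf : D.Smooth f) (hz : z ∈ D.toSet) :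
    DifferentiableAt ℝ f z :=
  (ContDiffOn.contDiffAt hf (D.isOpen_toSet.mem_nhds hz)).differentiableAt (by simp)

lemma Box.Smooth.hasLineDerivAt (hf : D.Smooth f) (hz : z ∈ D.toSet) (v : ℝ × ℝ × ℝ) :
    HasLineDerivAt ℝ f (_root_.dirDeriv v f z) z v :=
  (hf.differentiableAt hz).hasFDerivAt.hasLineDerivAt v

lemma dirDeriv_congr (h : EqOn f g D.toSet) (v : ℝ × ℝ × ℝ) :
    EqOn (dirDeriv v f) (dirDeriv v g) D.toSet := fun z hz => by
  unfold dirDeriv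
  rw [Filter.EventuallyEq.fderiv_eq (h.eventuallyEq_of_mem (D.isOpen_toSet.mem_nhds hz))]

lemma dirDeriv_eq_zero (h : EqOn f 0 D.toSet) (v : ℝ × ℝ × ℝ) :
    EqOn (dirDeriv v f) 0 D.toSet := fun z hz => by
  rw [dirDeriv_congr h v hz]
  simp [dirDeriv]

lemma iterate_dirDeriv_eq_zero (h : EqOn f 0 D.toSet) (v : ℝ × ℝ × ℝ) (k : ℕ) :
    EqOn ((dirDeriv v)^[k] f) 0 D.toSet := by
  induction k with
  | zero => exact h
  | succ k ih =>
    simp only [Function.iterate_succ_apply']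
    exact dirDeriv_eq_zero ih v

lemma Box.Smooth.dirDeriv_comm (hf : D.Smooth f) (v w : ℝ × ℝ × ℝ) :
    EqOn (_root_.dirDeriv v (_root_.dirDeriv w f)) (_root_.dirDeriv w (_root_.dirDeriv v f))
      D.toSet := fun z hz => by
  have hc : ContDiffAt ℝ ∞ f z := ContDiffOn.contDiffAt hf (D.isOpen_toSet.mem_nhds hz)
  have hs : IsSymmSndFDerivAt ℝ f z := hc.isSymmSndFDerivAt
    (by
      rw [minSmoothness_of_isRCLikeNormedField]
      exact WithTop.coe_le_coe.2 (le_top (a := (2 : ℕ∞))))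
  have hd : DifferentiableAt ℝ (fderiv ℝ f) z :=
    (hc.fderiv_right (m := ∞) (by simp)).differentiableAt (by simp)
  have key (a b : ℝ × ℝ × ℝ) :
      _root_.dirDeriv a (_root_.dirDeriv b f) z = fderiv ℝ (fderiv ℝ f) z a b := by
    unfold _root_.dirDeriv
    rw [fderiv_clm_apply hd (differentiableAt_const b)]
    simp
  rw [key, key]
  exact hs v w

lemma Box.Smooth.iterate_comm (hf : D.Smooth f) (v w : ℝ × ℝ × ℝ) (k : ℕ) :
    EqOn (_root_.dirDeriv v ((_root_.dirDeriv w)^[k] f))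
      ((_root_.dirDeriv w)^[k] (_root_.dirDeriv v f)) D.toSet := by
  induction k with
  | zero => exact fun _ _ => rfl
  | succ k ih =>
    simp only [Function.iterate_succ_apply']
    exact ((hf.iterate w k).dirDeriv_comm v w).trans (dirDeriv_congr ih w)

lemma Box.Smooth.exists_eq_const (hf : D.Smooth f) (ht : EqOn (pdt f) 0 D.toSet)
    (hx : EqOn (pdx f) 0 D.toSet) (hu : EqOn (pdu f) 0 D.toSet) :
    ∃ c, ∀ z ∈ D.toSet, f z = c := by
  refine D.isOpen_toSet.exists_is_const_of_fderiv_eq_zero D.convex_toSet.isPreconnected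
    (fun z hz => (hf.differentiableAt hz).differentiableWithinAt) fun z hz => ?_
  ext
  · have h : fderiv ℝ f z (1, 0) = 0 := ht hz
    simpa using h
  · have h : fderiv ℝ f z (0, 1, 0) = 0 := hx hz
    simpa using h
  · have h : fderiv ℝ f z (0, 0, 1) = 0 := hu hz
    simpa using h

end

/-! ### Total derivatives of differential functions -/

/-- The direction of the total derivative `D_x` at the jet `p`. -/
def Jet.dirX (p : Jet) : Jet := (0, 1, fun m => p.2.2 (m.1, m.2 + 1))

/-- `G` is the total derivative `D_x F` at all jets over the box, and `F` is differentiable there in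
the direction of `D_x`. -/
def HasDx (D : Box) (F G : Jet → ℝ) : Prop :=
  ∀ p : Jet, p.base ∈ D.toSet → HasLineDerivAt ℝ F (G p) p p.dirX

lemma Jet.base_add_smul (p q : Jet) (s : ℝ) : (p + s • q).base = p.base + s • q.base := rfl

lemma Jet.eventually_base_mem {D : Box} {p : Jet} (hp : p.base ∈ D.toSet) (q : Jet) :
    ∀ᶠ s : ℝ in nhds 0, (p + s • q).base ∈ D.toSet := by
  have : Continuous fun s : ℝ => (p + s • q).base := by
    simp only [Jet.base_add_smul]; fun_prop
  exact this.continuousAt.eventually_mem (D.isOpen_toSet.mem_nhds (by simpa using hp))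

/-- The jets on a short segment through `p` still lie over the open box, so a formula known only
over the box may be differentiated along any jet direction. -/
lemma lineDeriv_congr_over {D : Box} {F G : Jet → ℝ} (h : ∀ p : Jet, p.base ∈ D.toSet → F p = G p)
    {p : Jet} (hp : p.base ∈ D.toSet) (q : Jet) : lineDeriv ℝ F p q = lineDeriv ℝ G p q :=
  Filter.EventuallyEq.deriv_eq ((Jet.eventually_base_mem hp q).mono fun _ hs => h _ hs)

section
variable {D : Box} {F F' G G' : Jet → ℝ}

lemma HasDx.totalDx_eq (h : HasDx D F F') {p : Jet} (hp : p.base ∈ D.toSet) :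
    totalDx F p = F' p := (h p hp).lineDeriv

lemma HasDx.congr_right (h : HasDx D F F') (h' : ∀ p : Jet, p.base ∈ D.toSet → F' p = G' p) :
    HasDx D F G' := fun p hp => h' p hp ▸ h p hp

lemma HasDx.add (h : HasDx D F F') (h' : HasDx D G G') :
    HasDx D (fun p => F p + G p) (fun p => F' p + G' p) := fun p hp =>
  HasDerivAt.add (h p hp) (h' p hp)

lemma HasDx.sub (h : HasDx D F F') (h' : HasDx D G G') :
    HasDx D (fun p => F p - G p) (fun p => F' p - G' p) := fun p hp =>
  HasDerivAt.sub (h p hp) (h' p hp)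

lemma HasDx.mul (h : HasDx D F F') (h' : HasDx D G G') :
    HasDx D (fun p => F p * G p) (fun p => F' p * G p + F p * G' p) := fun p hp => by
  have := HasDerivAt.mul (h p hp) (h' p hp)
  rw [zero_smul, add_zero] at this
  exact this

lemma HasDx.const_mul (c : ℝ) (h : HasDx D F F') :
    HasDx D (fun p => c * F p) (fun p => c * F' p) := fun p hp =>
  HasDerivAt.const_mul c (h p hp)

lemma HasDx.pow (h : HasDx D F F') (k : ℕ) :
    HasDx D (fun p => F p ^ k) (fun p => k * F p ^ (k - 1) * F' p) := fun p hp => by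
  have := HasDerivAt.pow (h p hp) k
  rw [zero_smul, add_zero] at this
  exact this

lemma hasDx_coord (i j : ℕ) :
    HasDx D (fun p => p.2.2 (i, j)) (fun p => p.2.2 (i, j + 1)) := fun p _ => by
  have : HasDerivAt (fun s : ℝ => p.2.2 (i, j) + s * p.2.2 (i, j + 1)) (p.2.2 (i, j + 1)) 0 := by
    simpa using ((hasDerivAt_id (0 : ℝ)).mul_const (p.2.2 (i, j + 1))).const_add (p.2.2 (i, j))
  exact this

lemma Box.Smooth.hasLineDerivAt_base {f : ℝ × ℝ × ℝ → ℝ} (hf : D.Smooth f) {p : Jet}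
    (hp : p.base ∈ D.toSet) (q : Jet) :
    HasLineDerivAt ℝ (fun p : Jet => f p.base)
      (q.1 * pdt f p.base + q.2.1 * pdx f p.base + q.2.2 (0, 0) * pdu f p.base) p q := by
  have h := hf.hasLineDerivAt hp q.base
  have e : q.base = q.1 • ((1, 0, 0) : ℝ × ℝ × ℝ) + q.2.1 • ((0, 1, 0) : ℝ × ℝ × ℝ)
      + q.2.2 (0, 0) • ((0, 0, 1) : ℝ × ℝ × ℝ) := by
    simp [Jet.base]
  have e' : _root_.dirDeriv q.base f p.base
      = q.1 * pdt f p.base + q.2.1 * pdx f p.base + q.2.2 (0, 0) * pdu f p.base := by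
    unfold _root_.dirDeriv
    rw [e, map_add, map_add, map_smul, map_smul, map_smul]
    rfl
  rw [e'] at h
  exact h

/-- The mixed partial derivative `∂_x^a ∂_u^b f`. -/
def mixed (f : ℝ × ℝ × ℝ → ℝ) (a b : ℕ) : ℝ × ℝ × ℝ → ℝ := pdx^[a] (pdu^[b] f)

lemma Box.Smooth.mixed {f : ℝ × ℝ × ℝ → ℝ} (hf : D.Smooth f) (a b : ℕ) :
    D.Smooth (mixed f a b) := (hf.iterate _ b).iterate _ a

/-- The chain rule for `D_x`; symmetry of second derivatives moves the new `∂_u` past `∂_x^a` and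
restores the normal form of `mixed`. -/
lemma Box.Smooth.hasDx_mixed {f : ℝ × ℝ × ℝ → ℝ} (hf : D.Smooth f) (a b : ℕ) :
    HasDx D (fun p => _root_.mixed f a b p.base)
      (fun p => _root_.mixed f (a + 1) b p.base
        + p.2.2 (0, 1) * _root_.mixed f a (b + 1) p.base) := fun p hp => by
  have h := (hf.mixed a b).hasLineDerivAt_base hp p.dirX
  have e1 : pdx (_root_.mixed f a b) p.base = _root_.mixed f (a + 1) b p.base := by
    simp only [_root_.mixed, Function.iterate_succ_apply']
  have e2 : pdu (_root_.mixed f a b) p.base = _root_.mixed f a (b + 1) p.base := by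
    have := (hf.iterate (0, 0, 1) b).iterate_comm (0, 0, 1) (0, 1, 0) a hp
    simp only [_root_.mixed, Function.iterate_succ_apply']
    exact this
  rw [e1, e2] at h
  simpa [Jet.dirX] using h

end

/-- The total derivatives `D_x^k f`, `k ≤ 5`, of a function `f` of `(t, x, u)` (and `0` for `k > 5`). -/
def formalDx (f : ℝ × ℝ × ℝ → ℝ) (k : ℕ) (p : Jet) : ℝ :=
  let m := fun a b => mixed f a b p.base
  let u := fun j => p.2.2 (0, j)
  match k with
  | 0 => m 0 0
  | 1 => m 1 0 + u 1 * m 0 1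
  | 2 => m 2 0 + 2 * (u 1 * m 1 1) + u 1 ^ 2 * m 0 2 + u 2 * m 0 1
  | 3 => m 3 0 + 3 * (u 1 * m 2 1) + 3 * (u 1 ^ 2 * m 1 2) + u 1 ^ 3 * m 0 3
      + 3 * (u 2 * m 1 1) + 3 * (u 1 * u 2 * m 0 2) + u 3 * m 0 1
  | 4 => m 4 0 + 4 * (u 1 * m 3 1) + 6 * (u 1 ^ 2 * m 2 2) + 4 * (u 1 ^ 3 * m 1 3)
      + u 1 ^ 4 * m 0 4 + 6 * (u 2 * m 2 1) + 12 * (u 1 * u 2 * m 1 2)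
      + 6 * (u 1 ^ 2 * u 2 * m 0 3) + 3 * (u 2 ^ 2 * m 0 2) + 4 * (u 3 * m 1 1)
      + 4 * (u 1 * u 3 * m 0 2) + u 4 * m 0 1
  | 5 => m 5 0 + 5 * (u 1 * m 4 1) + 10 * (u 1 ^ 2 * m 3 2) + 10 * (u 1 ^ 3 * m 2 3)
      + 5 * (u 1 ^ 4 * m 1 4) + u 1 ^ 5 * m 0 5 + 10 * (u 2 * m 3 1) + 30 * (u 1 * u 2 * m 2 2)
      + 30 * (u 1 ^ 2 * u 2 * m 1 3) + 10 * (u 1 ^ 3 * u 2 * m 0 4) + 15 * (u 2 ^ 2 * m 1 2)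
      + 15 * (u 1 * u 2 ^ 2 * m 0 3) + 10 * (u 3 * m 2 1) + 20 * (u 1 * u 3 * m 1 2)
      + 10 * (u 1 ^ 2 * u 3 * m 0 3) + 10 * (u 2 * u 3 * m 0 2) + 5 * (u 4 * m 1 1)
      + 5 * (u 1 * u 4 * m 0 2) + u 5 * m 0 1
  | _ => 0

section
variable {D : Box} {f : ℝ × ℝ × ℝ → ℝ}

lemma Box.Smooth.hasDx_formalDx_zero (hf : D.Smooth f) :
    HasDx D (formalDx f 0) (formalDx f 1) := hf.hasDx_mixed 0 0

lemma Box.Smooth.hasDx_formalDx_one (hf : D.Smooth f) :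
    HasDx D (formalDx f 1) (formalDx f 2) := by
  have m := fun a b => hf.hasDx_mixed a b
  have u := fun j => hasDx_coord (D := D) 0 j
  refine ((m 1 0).add ((u 1).mul (m 0 1))).congr_right fun p _ => ?_
  simp only [formalDx]
  ring

lemma Box.Smooth.hasDx_formalDx_two (hf : D.Smooth f) :
    HasDx D (formalDx f 2) (formalDx f 3) := by
  have m := fun a b => hf.hasDx_mixed a b
  have u := fun j => hasDx_coord (D := D) 0 j
  refine ((((m 2 0).add (((u 1).mul (m 1 1)).const_mul 2)).add (((u 1).pow 2).mul (m 0 2))).add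
    ((u 2).mul (m 0 1))).congr_right fun p _ => ?_
  simp only [formalDx]
  push_cast
  ring

lemma Box.Smooth.hasDx_formalDx_three (hf : D.Smooth f) :
    HasDx D (formalDx f 3) (formalDx f 4) := by
  have m := fun a b => hf.hasDx_mixed a b
  have u := fun j => hasDx_coord (D := D) 0 j
  refine (((((((m 3 0).add (((u 1).mul (m 2 1)).const_mul 3)).add
    ((((u 1).pow 2).mul (m 1 2)).const_mul 3)).add (((u 1).pow 3).mul (m 0 3))).add
    (((u 2).mul (m 1 1)).const_mul 3)).add ((((u 1).mul (u 2)).mul (m 0 2)).const_mul 3)).add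
    ((u 3).mul (m 0 1))).congr_right fun p _ => ?_
  simp only [formalDx]
  push_cast
  ring

lemma Box.Smooth.hasDx_formalDx_four (hf : D.Smooth f) :
    HasDx D (formalDx f 4) (formalDx f 5) := by
  have m := fun a b => hf.hasDx_mixed a b
  have u := fun j => hasDx_coord (D := D) 0 j
  refine ((((((((((((m 4 0).add (((u 1).mul (m 3 1)).const_mul 4)).add
    ((((u 1).pow 2).mul (m 2 2)).const_mul 6)).add ((((u 1).pow 3).mul (m 1 3)).const_mul 4)).add
    (((u 1).pow 4).mul (m 0 4))).add (((u 2).mul (m 2 1)).const_mul 6)).add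
    ((((u 1).mul (u 2)).mul (m 1 2)).const_mul 12)).add
    (((((u 1).pow 2).mul (u 2)).mul (m 0 3)).const_mul 6)).add
    ((((u 2).pow 2).mul (m 0 2)).const_mul 3)).add (((u 3).mul (m 1 1)).const_mul 4)).add
    ((((u 1).mul (u 3)).mul (m 0 2)).const_mul 4)).add
    ((u 4).mul (m 0 1))).congr_right fun p _ => ?_
  simp only [formalDx]
  push_cast
  ring

lemma Box.Smooth.hasDx_formalDx (hf : D.Smooth f) :
    ∀ k < 5, HasDx D (formalDx f k) (formalDx f (k + 1))
  | 0, _ => hf.hasDx_formalDx_zero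
  | 1, _ => hf.hasDx_formalDx_one
  | 2, _ => hf.hasDx_formalDx_two
  | 3, _ => hf.hasDx_formalDx_three
  | 4, _ => hf.hasDx_formalDx_four

end

/-! ### Prolongation -/

/-- The components `τ`, `ξ` and `η` of `Q` are smooth on the box. -/
structure VField.SmoothOn (Q : VField) (D : Box) : Prop where
  tau : D.Smooth fun z => (Q z).1
  xi : D.Smooth fun z => (Q z).2.1
  eta : D.Smooth fun z => (Q z).2.2

lemma VField.smoothOn_of_contDiffOn {Q : VField} {D : Box} (h : ContDiffOn ℝ ∞ Q D.toSet) :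
    Q.SmoothOn D := ⟨h.fst, h.snd.fst, h.snd.snd⟩

/-- Unrolling the recursion as in the Leibniz rule gives `D_x^5 η - ∑ binom(5,k) (D_x^k τ ·
u_{1,5-k} + D_x^k ξ · u_{0,6-k})` over `1 ≤ k ≤ 5`. -/
lemma VField.SmoothOn.prolongCoeff_zero_five {Q : VField} {D : Box} (hQ : Q.SmoothOn D) {p : Jet}
    (hp : p.base ∈ D.toSet) :
    let T := fun k => formalDx (fun z => (Q z).1) k p
    let X := fun k => formalDx (fun z => (Q z).2.1) k p
    let u := fun j => p.2.2 (0, j)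
    let w := fun j => p.2.2 (1, j)
    Q.prolongCoeff 0 5 p = formalDx (fun z => (Q z).2.2) 5 p - 5 * (T 1 * w 4 + X 1 * u 5)
      - 10 * (T 2 * w 3 + X 2 * u 4) - 10 * (T 3 * w 2 + X 3 * u 3) - 5 * (T 4 * w 1 + X 4 * u 2)
      - (T 5 * w 0 + X 5 * u 1) := by
  have T := hQ.tau.hasDx_formalDx
  have X := hQ.xi.hasDx_formalDx
  have N := hQ.eta.hasDx_formalDx
  have w := fun j => hasDx_coord (D := D) 1 j
  have u := fun j => hasDx_coord (D := D) 0 j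
  have hT (p : Jet) (hp : p.base ∈ D.toSet) := (T 0 (by norm_num)).totalDx_eq hp
  have hX (p : Jet) (hp : p.base ∈ D.toSet) := (X 0 (by norm_num)).totalDx_eq hp
  have tm (k a : ℕ) (hk : k < 5) (c : ℝ) :=
    (((T k hk).mul (w a)).add ((X k hk).mul (u (a + 1)))).const_mul c
  have step (j : ℕ) (F F' : Jet → ℝ) (h : ∀ p : Jet, p.base ∈ D.toSet → Q.prolongCoeff 0 j p = F p)
      (hF : HasDx D F F') (p : Jet) (hp : p.base ∈ D.toSet) : Q.prolongCoeff 0 (j + 1) p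
        = F' p - p.2.2 (1, j) * formalDx (fun z => (Q z).1) 1 p
          - p.2.2 (0, j + 1) * formalDx (fun z => (Q z).2.1) 1 p := by
    have e : totalDx (Q.prolongCoeff 0 j) p = F' p :=
      (lineDeriv_congr_over h hp _).trans (hF.totalDx_eq hp)
    rw [← e, ← hT p hp, ← hX p hp]
    rfl
  have h0 : ∀ p : Jet, p.base ∈ D.toSet →
      Q.prolongCoeff 0 0 p = formalDx (fun z => (Q z).2.2) 0 p := fun p _ => rfl
  have h1 := step 0 _ _ h0 (N 0 (by norm_num))
  -- Each `hk'` describes the coefficient of order `k + 1`. The `show` puts the previous one in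
  -- binomial form; the literal factors `1 *` match the shape that `tm` differentiates.
  have h1' := step 1 _ _ (fun p hp => (h1 p hp).trans (show _ =
    formalDx (fun z => (Q z).2.2) 1 p - 1 * (formalDx (fun z => (Q z).1) 1 p * p.2.2 (1, 0)
      + formalDx (fun z => (Q z).2.1) 1 p * p.2.2 (0, 1)) by ring))
    ((N 1 (by norm_num)).sub (tm 1 0 (by norm_num) 1))
  have h2' := step 2 _ _ (fun p hp => (h1' p hp).trans (show _ =
    formalDx (fun z => (Q z).2.2) 2 p - 2 * (formalDx (fun z => (Q z).1) 1 p * p.2.2 (1, 1)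
      + formalDx (fun z => (Q z).2.1) 1 p * p.2.2 (0, 2))
      - 1 * (formalDx (fun z => (Q z).1) 2 p * p.2.2 (1, 0)
      + formalDx (fun z => (Q z).2.1) 2 p * p.2.2 (0, 1)) by ring))
    (((N 2 (by norm_num)).sub (tm 1 1 (by norm_num) 2)).sub (tm 2 0 (by norm_num) 1))
  have h3' := step 3 _ _ (fun p hp => (h2' p hp).trans (show _ =
    formalDx (fun z => (Q z).2.2) 3 p - 3 * (formalDx (fun z => (Q z).1) 1 p * p.2.2 (1, 2)
      + formalDx (fun z => (Q z).2.1) 1 p * p.2.2 (0, 3))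
      - 3 * (formalDx (fun z => (Q z).1) 2 p * p.2.2 (1, 1)
      + formalDx (fun z => (Q z).2.1) 2 p * p.2.2 (0, 2))
      - 1 * (formalDx (fun z => (Q z).1) 3 p * p.2.2 (1, 0)
      + formalDx (fun z => (Q z).2.1) 3 p * p.2.2 (0, 1)) by ring))
    ((((N 3 (by norm_num)).sub (tm 1 2 (by norm_num) 3)).sub (tm 2 1 (by norm_num) 3)).sub
      (tm 3 0 (by norm_num) 1))
  have h4' := step 4 _ _ (fun p hp => (h3' p hp).trans (show _ =
    formalDx (fun z => (Q z).2.2) 4 p - 4 * (formalDx (fun z => (Q z).1) 1 p * p.2.2 (1, 3)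
      + formalDx (fun z => (Q z).2.1) 1 p * p.2.2 (0, 4))
      - 6 * (formalDx (fun z => (Q z).1) 2 p * p.2.2 (1, 2)
      + formalDx (fun z => (Q z).2.1) 2 p * p.2.2 (0, 3))
      - 4 * (formalDx (fun z => (Q z).1) 3 p * p.2.2 (1, 1)
      + formalDx (fun z => (Q z).2.1) 3 p * p.2.2 (0, 2))
      - 1 * (formalDx (fun z => (Q z).1) 4 p * p.2.2 (1, 0)
      + formalDx (fun z => (Q z).2.1) 4 p * p.2.2 (0, 1)) by ring))
    (((((N 4 (by norm_num)).sub (tm 1 3 (by norm_num) 4)).sub (tm 2 2 (by norm_num) 6)).sub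
      (tm 3 1 (by norm_num) 4)).sub (tm 4 0 (by norm_num) 1))
  rw [h4' p hp]
  dsimp only
  ring

/-- This is the side condition under which `u ↦ u ^ n` is differentiable at `u`; it also covers `0 ∈
U` for a positive integer `n`. -/
lemma PowDefined.ne_zero_or_one_le {n : ℝ} {S : Set ℝ} (h : PowDefined n S) (hn : n ≠ 0) {u : ℝ}
    (hu : u ∈ S) : u ≠ 0 ∨ 1 ≤ n := by
  rcases h with h | ⟨-, h⟩ | ⟨k, rfl⟩
  · exact .inl (h hu).ne'
  · exact .inl fun h0 => h (h0 ▸ hu)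
  · exact .inr (by exact_mod_cast Nat.one_le_iff_ne_zero.2 (by simpa using hn))

lemma IsCoefficient.hasDerivAt {D : Box} {β : ℝ → ℝ} (hβ : IsCoefficient D.J β) {t : ℝ}
    (ht : t ∈ D.J) : HasDerivAt β (deriv β t) t :=
  ((hβ.1.contDiffAt (D.isOpen_J.mem_nhds ht)).differentiableAt (by simp)).hasDerivAt

section
variable {n : ℝ} {D : Box} {β : ℝ → ℝ} {Q : VField}

lemma hasLineDerivAt_fkdv (hn : n ≠ 0) (hU : PowDefined n D.U) (hβ : IsCoefficient D.J β) {p : Jet}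
    (hp : p.base ∈ D.toSet) (q : Jet) :
    HasLineDerivAt ℝ (fkdv n β) (q.2.2 (1, 0)
      + (n * p.2.2 (0, 0) ^ (n - 1) * q.2.2 (0, 0) * p.2.2 (0, 1)
        + p.2.2 (0, 0) ^ n * q.2.2 (0, 1))
      + (deriv β p.1 * q.1 * p.2.2 (0, 5) + β p.1 * q.2.2 (0, 5))) p q := by
  have c (i j : ℕ) : HasDerivAt (fun s : ℝ => (p + s • q).2.2 (i, j)) (q.2.2 (i, j)) 0 := by
    have : HasDerivAt (fun s : ℝ => p.2.2 (i, j) + s * q.2.2 (i, j)) (q.2.2 (i, j)) 0 := by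
      simpa using ((hasDerivAt_id (0 : ℝ)).mul_const (q.2.2 (i, j))).const_add (p.2.2 (i, j))
    exact this
  have ct : HasDerivAt (fun s : ℝ => (p + s • q).1) q.1 0 := by
    have : HasDerivAt (fun s : ℝ => p.1 + s * q.1) q.1 0 := by
      simpa using ((hasDerivAt_id (0 : ℝ)).mul_const q.1).const_add p.1
    exact this
  have hb : HasDerivAt (fun s : ℝ => β (p + s • q).1) (deriv β p.1 * q.1) 0 := by
    have h := hβ.hasDerivAt hp.1
    refine HasDerivAt.comp (0 : ℝ) (h₂ := β) ?_ ct
    simpa [Jet.base] using h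
  have hpw : HasDerivAt (fun s : ℝ => (p + s • q).2.2 (0, 0) ^ n)
      (n * p.2.2 (0, 0) ^ (n - 1) * q.2.2 (0, 0)) 0 := by
    have h := Real.hasDerivAt_rpow_const (hU.ne_zero_or_one_le hn hp.2.2)
    refine HasDerivAt.comp (0 : ℝ) (h₂ := fun x : ℝ => x ^ n) ?_ (c 0 0)
    simpa [Jet.base] using h
  have := ((c 1 0).add (hpw.mul (c 0 1))).add (hb.mul (c 0 5))
  simp only [zero_smul, add_zero] at this
  exact this

lemma VField.SmoothOn.prolongCoeff_one_zero (hQ : Q.SmoothOn D) {p : Jet}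
    (hp : p.base ∈ D.toSet) :
    Q.prolongCoeff 1 0 p
      = (pdt (fun z => (Q z).2.2) p.base + p.2.2 (1, 0) * pdu (fun z => (Q z).2.2) p.base)
      - p.2.2 (1, 0) * (pdt (fun z => (Q z).1) p.base + p.2.2 (1, 0) * pdu (fun z => (Q z).1) p.base)
      - p.2.2 (0, 1) * (pdt (fun z => (Q z).2.1) p.base
        + p.2.2 (1, 0) * pdu (fun z => (Q z).2.1) p.base) := by
  have key {f : ℝ × ℝ × ℝ → ℝ} (hf : D.Smooth f) : totalDt (fun p : Jet => f p.base) p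
      = pdt f p.base + p.2.2 (1, 0) * pdu f p.base := by
    refine (hf.hasLineDerivAt_base hp _).lineDeriv.trans ?_
    simp
  rw [← key hQ.tau, ← key hQ.xi, ← key hQ.eta]
  rfl

lemma VField.SmoothOn.prolongCoeff_zero_one (hQ : Q.SmoothOn D) {p : Jet}
    (hp : p.base ∈ D.toSet) :
    Q.prolongCoeff 0 1 p = formalDx (fun z => (Q z).2.2) 1 p
      - p.2.2 (1, 0) * formalDx (fun z => (Q z).1) 1 p
      - p.2.2 (0, 1) * formalDx (fun z => (Q z).2.1) 1 p := by
  rw [← (hQ.tau.hasDx_formalDx_zero).totalDx_eq hp, ← (hQ.xi.hasDx_formalDx_zero).totalDx_eq hp,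
    ← (hQ.eta.hasDx_formalDx_zero).totalDx_eq hp]
  rfl

lemma prolong_fkdv (hn : n ≠ 0) (hU : PowDefined n D.U) (hβ : IsCoefficient D.J β) {p : Jet}
    (hp : p.base ∈ D.toSet) :
    Q.prolong 5 (fkdv n β) p = Q.prolongCoeff 1 0 p
      + (n * p.2.2 (0, 0) ^ (n - 1) * (Q p.base).2.2 * p.2.2 (0, 1)
        + p.2.2 (0, 0) ^ n * Q.prolongCoeff 0 1 p)
      + (deriv β p.1 * (Q p.base).1 * p.2.2 (0, 5) + β p.1 * Q.prolongCoeff 0 5 p) := by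
  refine (hasLineDerivAt_fkdv hn hU hβ hp _).lineDeriv.trans ?_
  simp
  rfl

/-! ### The determining equations -/

/-- The jet over `z` with `u_t = r`, `u_j = a_j` and `u_{1,4} = w`, and with all other derivatives
equal to zero. -/
def mkJet (z : ℝ × ℝ × ℝ) (r a₁ a₂ a₃ a₄ a₅ w : ℝ) : Jet :=
  (z.1, z.2.1, fun m => match m with
    | (0, 0) => z.2.2
    | (0, 1) => a₁
    | (0, 2) => a₂
    | (0, 3) => a₃
    | (0, 4) => a₄
    | (0, 5) => a₅
    | (1, 0) => r
    | (1, 4) => w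
    | _ => 0)

/-- The value `r` solves the equation for `u_t`, so the other arguments are free and the identity
can be split in them. In `mkJet` the derivatives `u_{1,1}, u_{1,2}, u_{1,3}` are zero, which removes
the terms with `D_x^k τ` for `k = 2, 3, 4`. -/
lemma determining_equation (hn : n ≠ 0) (hU : PowDefined n D.U) (hβ : IsCoefficient D.J β)
    (hQ : Q ∈ maxAlgebra n D β) {z : ℝ × ℝ × ℝ} (hz : z ∈ D.toSet) (a₁ a₂ a₃ a₄ a₅ w : ℝ) :
    let τ := fun z => (Q z).1
    let ξ := fun z => (Q z).2.1
    let η := fun z => (Q z).2.2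
    let r := -(z.2.2 ^ n * a₁ + β z.1 * a₅)
    let p := mkJet z r a₁ a₂ a₃ a₄ a₅ w
    (pdt η z + r * pdu η z) - r * (pdt τ z + r * pdu τ z) - a₁ * (pdt ξ z + r * pdu ξ z)
      + (n * z.2.2 ^ (n - 1) * η z * a₁
        + z.2.2 ^ n * (formalDx η 1 p - r * formalDx τ 1 p - a₁ * formalDx ξ 1 p))
      + (deriv β z.1 * τ z * a₅ + β z.1 * (formalDx η 5 p
        - 5 * (formalDx τ 1 p * w + formalDx ξ 1 p * a₅) - 10 * formalDx ξ 2 p * a₄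
        - 10 * formalDx ξ 3 p * a₃ - 5 * formalDx ξ 4 p * a₂
        - (formalDx τ 5 p * r + formalDx ξ 5 p * a₁))) = 0 := by
  intro τ ξ η r p
  have hp : p.base ∈ D.toSet := hz
  have hs := VField.smoothOn_of_contDiffOn hQ.1
  have h0 : fkdv n β p = 0 := by
    simp only [fkdv, p, mkJet, r]; ring
  have h := hQ.2.2 p hp h0
  rw [prolong_fkdv hn hU hβ hp, hs.prolongCoeff_one_zero hp, hs.prolongCoeff_zero_one hp,
    hs.prolongCoeff_zero_five hp] at h
  rw [← h]
  simp only [p, mkJet, Jet.base, τ, ξ, η]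
  ring

lemma mixed_eq_zero_of_pdu {f : ℝ × ℝ × ℝ → ℝ} (h : EqOn (pdu f) 0 D.toSet) (a b : ℕ) :
    EqOn (mixed f a (b + 1)) 0 D.toSet := by
  refine iterate_dirDeriv_eq_zero ?_ _ a
  rw [Function.iterate_succ_apply]
  exact iterate_dirDeriv_eq_zero h _ b

lemma mixed_eq_zero_of_pdx {f : ℝ × ℝ × ℝ → ℝ} (h : EqOn (pdx f) 0 D.toSet) (a : ℕ) :
    EqOn (mixed f (a + 1) 0) 0 D.toSet := by
  unfold mixed
  rw [Function.iterate_succ_apply]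
  exact iterate_dirDeriv_eq_zero h _ a

/-- The coordinate `w = u_{1,4}` enters only through `-5 β D_xτ · w`. Hence `τ_x + u_1 τ_u = 0`,
which is read at `u_1 = 0` and `u_1 = 1`. -/
lemma determining_tau (hn : n ≠ 0) (hU : PowDefined n D.U) (hβ : IsCoefficient D.J β)
    (hQ : Q ∈ maxAlgebra n D β) :
    EqOn (pdx fun z => (Q z).1) 0 D.toSet ∧ EqOn (pdu fun z => (Q z).1) 0 D.toSet := by
  have key (z) (hz : z ∈ D.toSet) : pdx (fun z => (Q z).1) z = 0 ∧ pdu (fun z => (Q z).1) z = 0 := by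
    have h := determining_equation hn hU hβ hQ hz
    have h1 := h 0 0 0 0 0 0
    have h2 := h 0 0 0 0 0 1
    have h3 := h 1 0 0 0 0 0
    have h4 := h 1 0 0 0 0 1
    simp only [formalDx, mkJet] at h1 h2 h3 h4
    have hb := hβ.2 _ hz.1
    have e1 : mixed (fun z => (Q z).1) 1 0 z = 0 := by
      have : β z.1 * mixed (fun z => (Q z).1) 1 0 z = 0 := by
        simp only [Jet.base] at h1 h2 h3 h4
        linear_combination (h1 - h2) / 5
      simpa [hb] using this
    have e2 : mixed (fun z => (Q z).1) 0 1 z = 0 := by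
      have : β z.1 * (mixed (fun z => (Q z).1) 1 0 z + mixed (fun z => (Q z).1) 0 1 z) = 0 := by
        simp only [Jet.base] at h1 h2 h3 h4
        linear_combination (h3 - h4) / 5
      simpa [hb, e1] using this
    exact ⟨e1, e2⟩
  exact ⟨fun z hz => (key z hz).1, fun z hz => (key z hz).2⟩

end

section
variable {n : ℝ} {D : Box} {β : ℝ → ℝ} {Q : VField}

lemma formalDx_eq_zero {f : ℝ × ℝ × ℝ → ℝ} (hx : EqOn (pdx f) 0 D.toSet)
    (hu : EqOn (pdu f) 0 D.toSet) {p : Jet} (hp : p.base ∈ D.toSet) (k : ℕ) :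
    formalDx f (k + 1) p = 0 := by
  have h1 (a b : ℕ) : mixed f a (b + 1) p.base = 0 := mixed_eq_zero_of_pdu hu a b hp
  have h2 (a : ℕ) : mixed f (a + 1) 0 p.base = 0 := mixed_eq_zero_of_pdx hx a hp
  match k with
  | 0 | 1 | 2 | 3 | 4 => simp [formalDx, h1, h2]
  | _ + 5 => rfl

lemma mkJet_base_mem {z : ℝ × ℝ × ℝ} (hz : z ∈ D.toSet) (r a₁ a₂ a₃ a₄ a₅ w : ℝ) :
    (mkJet z r a₁ a₂ a₃ a₄ a₅ w).base ∈ D.toSet := hz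

/-- The coefficient of `u_5`, as a polynomial in `u_1`. The contributions of `η_u` from `u_t` and
from `D_x^5 η` cancel, leaving the relation that ties `β` to the symmetry. -/
lemma determining_xi (hn : n ≠ 0) (hU : PowDefined n D.U) (hβ : IsCoefficient D.J β)
    (hQ : Q ∈ maxAlgebra n D β) :
    EqOn (pdu fun z => (Q z).2.1) 0 D.toSet ∧
    ∀ z ∈ D.toSet, 5 * β z.1 * pdx (fun z => (Q z).2.1) z
      = deriv β z.1 * (Q z).1 + β z.1 * pdt (fun z => (Q z).1) z := by
  obtain ⟨hx, hu⟩ := determining_tau hn hU hβ hQ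
  have key (z) (hz : z ∈ D.toSet) (a₁ : ℝ) : 5 * β z.1 * (pdx (fun z => (Q z).2.1) z
      + a₁ * pdu (fun z => (Q z).2.1) z)
      = deriv β z.1 * (Q z).1 + β z.1 * pdt (fun z => (Q z).1) z := by
    have h := determining_equation hn hU hβ hQ hz
    have h1 := h a₁ 0 0 0 0 0
    have h2 := h a₁ 0 0 0 1 0
    dsimp only at h1 h2
    have hJ {r a₁ a₂ a₃ a₄ a₅ w} := mkJet_base_mem hz r a₁ a₂ a₃ a₄ a₅ w
    rw [formalDx_eq_zero hx hu hJ 0, formalDx_eq_zero hx hu hJ 4, hu hz] at h1 h2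
    simp only [formalDx, mkJet, Jet.base, Pi.zero_apply] at h1 h2
    have e1 : mixed (fun z => (Q z).2.1) 1 0 z = pdx (fun z => (Q z).2.1) z := rfl
    have e2 : mixed (fun z => (Q z).2.1) 0 1 z = pdu (fun z => (Q z).2.1) z := rfl
    have e3 : mixed (fun z => (Q z).2.2) 0 1 z = pdu (fun z => (Q z).2.2) z := rfl
    simp only [e1, e2, e3] at h1 h2
    linear_combination h1 - h2
  refine ⟨fun z hz => ?_, fun z hz => by simpa using key z hz 0⟩
  have h : 5 * β z.1 * pdu (fun z => (Q z).2.1) z = 0 := by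
    linear_combination key z hz 1 - key z hz 0
  simpa [hβ.2 _ hz.1] using h

/-- The relation for `ξ_x` is differentiated in `x`: its right-hand side involves only `β`, `τ` and
`τ_t`, which do not depend on `x`. -/
lemma determining_xi_xx (hn : n ≠ 0) (hU : PowDefined n D.U) (hβ : IsCoefficient D.J β)
    (hQ : Q ∈ maxAlgebra n D β) :
    EqOn (pdx (pdx fun z => (Q z).2.1)) 0 D.toSet := fun z hz => by
  have hs := VField.smoothOn_of_contDiffOn hQ.1
  obtain ⟨hx, -⟩ := determining_tau hn hU hβ hQ
  obtain ⟨-, h⟩ := determining_xi hn hU hβ hQ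
  have h1 := ((hs.xi.dirDeriv (0, 1, 0)).hasLineDerivAt hz (0, 1, 0)).const_mul (5 * β z.1)
  have h2 := (hs.tau.hasLineDerivAt hz (0, 1, 0)).const_mul (deriv β z.1)
  have h3 := ((hs.tau.dirDeriv (1, 0, 0)).hasLineDerivAt hz (0, 1, 0)).const_mul (β z.1)
  have e : pdx (pdt fun z => (Q z).1) z = 0 :=
    (hs.tau.dirDeriv_comm (0, 1, 0) (1, 0, 0) hz).trans (dirDeriv_eq_zero hx _ hz)
  have h4 := h2.add h3
  have ev : ∀ᶠ s : ℝ in nhds 0, z + s • ((0, 1, 0) : ℝ × ℝ × ℝ) ∈ D.toSet := by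
    have : Continuous fun s : ℝ => z + s • ((0, 1, 0) : ℝ × ℝ × ℝ) := by fun_prop
    exact this.continuousAt.eventually_mem (D.isOpen_toSet.mem_nhds (by simpa using hz))
  have h5 := h1.unique (h4.congr_of_eventuallyEq (ev.mono fun s hs => by simpa using h _ hs))
  rw [show dirDeriv (0, 1, 0) (fun z => (Q z).1) z = 0 from hx hz,
    show dirDeriv (0, 1, 0) (dirDeriv (1, 0, 0) fun z => (Q z).1) z = 0 from e] at h5
  simpa [hβ.2 _ hz.1] using h5

lemma mixed_eq_zero_of_pdu_pdu {f : ℝ × ℝ × ℝ → ℝ} (h : EqOn (pdu (pdu f)) 0 D.toSet) (a b : ℕ) :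
    EqOn (mixed f a (b + 2)) 0 D.toSet := mixed_eq_zero_of_pdu (f := pdu f) h a b

lemma mixed_eq_zero_of_pdx_pdu {f : ℝ × ℝ × ℝ → ℝ} (h : EqOn (pdx (pdu f)) 0 D.toSet) (a : ℕ) :
    EqOn (mixed f (a + 1) 1) 0 D.toSet := mixed_eq_zero_of_pdx (f := pdu f) h a

lemma mixed_eq_zero_of_pdx_pdx {f : ℝ × ℝ × ℝ → ℝ} (h : EqOn (pdx (pdx f)) 0 D.toSet) (a : ℕ) :
    EqOn (mixed f (a + 2) 0) 0 D.toSet := mixed_eq_zero_of_pdx (f := pdx f) h a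

lemma formalDx_xi {f : ℝ × ℝ × ℝ → ℝ} (hxx : EqOn (pdx (pdx f)) 0 D.toSet)
    (hu : EqOn (pdu f) 0 D.toSet) {p : Jet} (hp : p.base ∈ D.toSet) (k : ℕ) :
    formalDx f (k + 2) p = 0 := by
  have h1 (a b : ℕ) : mixed f a (b + 1) p.base = 0 := mixed_eq_zero_of_pdu hu a b hp
  have h2 (a : ℕ) : mixed f (a + 2) 0 p.base = 0 := mixed_eq_zero_of_pdx_pdx hxx a hp
  match k with
  | 0 | 1 | 2 | 3 => simp [formalDx, h1, h2]
  | _ + 4 => rfl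

/-- With `D_x^2 ξ = 0`, the coefficient of `u_4` is `5 β (η_xu + u_1 η_uu)`, and `u_1` is arbitrary.
-/
lemma determining_eta (hn : n ≠ 0) (hU : PowDefined n D.U) (hβ : IsCoefficient D.J β)
    (hQ : Q ∈ maxAlgebra n D β) :
    EqOn (pdu (pdu fun z => (Q z).2.2)) 0 D.toSet ∧
    EqOn (pdx (pdu fun z => (Q z).2.2)) 0 D.toSet := by
  obtain ⟨hx, hu⟩ := determining_tau hn hU hβ hQ
  obtain ⟨hξ, -⟩ := determining_xi hn hU hβ hQ
  have hξx := determining_xi_xx hn hU hβ hQ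
  have key (z) (hz : z ∈ D.toSet) (a₁ : ℝ) : pdx (pdu fun z => (Q z).2.2) z
      + a₁ * pdu (pdu fun z => (Q z).2.2) z = 0 := by
    have h := determining_equation hn hU hβ hQ hz
    have h1 := h a₁ 0 0 0 0 0
    have h2 := h a₁ 0 0 1 0 0
    dsimp only at h1 h2
    have hJ {r a₁ a₂ a₃ a₄ a₅ w} := mkJet_base_mem hz r a₁ a₂ a₃ a₄ a₅ w
    rw [formalDx_eq_zero hx hu hJ 0, formalDx_eq_zero hx hu hJ 4, hu hz,
      formalDx_xi hξx hξ hJ 0,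
      formalDx_xi hξx hξ hJ 1, formalDx_xi hξx hξ hJ 2, formalDx_xi hξx hξ hJ 3] at h1 h2
    simp only [formalDx, mkJet, Jet.base, Pi.zero_apply] at h1 h2
    have e1 : mixed (fun z => (Q z).2.2) 1 1 z = pdx (pdu fun z => (Q z).2.2) z := rfl
    have e2 : mixed (fun z => (Q z).2.2) 0 2 z = pdu (pdu fun z => (Q z).2.2) z := rfl
    simp only [e1, e2] at h1 h2
    have : 5 * β z.1 * (pdx (pdu fun z => (Q z).2.2) z
      + a₁ * pdu (pdu fun z => (Q z).2.2) z) = 0 := by linear_combination h2 - h1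
    simpa [hβ.2 _ hz.1] using this
  have key0 (z) (hz : z ∈ D.toSet) : pdx (pdu fun z => (Q z).2.2) z = 0 := by
    simpa using key z hz 0
  exact ⟨fun z hz => by simpa [key0 z hz] using key z hz 1, key0⟩

/-- The surviving condition is affine in `u_1`, so the jets with `u_1 = 0` and `u_1 = 1` exhaust it.
-/
lemma determining_rest (hn : n ≠ 0) (hU : PowDefined n D.U) (hβ : IsCoefficient D.J β)
    (hQ : Q ∈ maxAlgebra n D β) {z : ℝ × ℝ × ℝ} (hz : z ∈ D.toSet) :
    pdt (fun z => (Q z).2.2) z + z.2.2 ^ n * pdx (fun z => (Q z).2.2) z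
      + β z.1 * mixed (fun z => (Q z).2.2) 5 0 z = 0 ∧
    z.2.2 ^ n * (pdt (fun z => (Q z).1) z - pdx (fun z => (Q z).2.1) z)
      + n * z.2.2 ^ (n - 1) * (Q z).2.2 - pdt (fun z => (Q z).2.1) z = 0 := by
  obtain ⟨hx, hu⟩ := determining_tau hn hU hβ hQ
  obtain ⟨hξ, -⟩ := determining_xi hn hU hβ hQ
  have hξx := determining_xi_xx hn hU hβ hQ
  obtain ⟨huu, hxu⟩ := determining_eta hn hU hβ hQ
  have m1 (a b : ℕ) := mixed_eq_zero_of_pdu_pdu huu a b hz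
  have m2 (a : ℕ) := mixed_eq_zero_of_pdx_pdu hxu a hz
  have h := determining_equation hn hU hβ hQ hz
  have h1 := h 0 0 0 0 0 0
  have h2 := h 1 0 0 0 0 0
  dsimp only at h1 h2
  have hJ {r a₁ a₂ a₃ a₄ a₅ w} := mkJet_base_mem hz r a₁ a₂ a₃ a₄ a₅ w
  rw [formalDx_eq_zero hx hu hJ 0, formalDx_eq_zero hx hu hJ 4, hu hz, hξ hz,
    formalDx_xi hξx hξ hJ 0,
    formalDx_xi hξx hξ hJ 1, formalDx_xi hξx hξ hJ 2, formalDx_xi hξx hξ hJ 3] at h1 h2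
  simp only [formalDx, mkJet, Jet.base, Pi.zero_apply] at h1 h2
  have e1 : mixed (fun z => (Q z).2.2) 1 0 z = pdx (fun z => (Q z).2.2) z := rfl
  have e2 : mixed (fun z => (Q z).2.2) 0 1 z = pdu (fun z => (Q z).2.2) z := rfl
  have e3 : mixed (fun z => (Q z).2.1) 1 0 z = pdx (fun z => (Q z).2.1) z := rfl
  have e4 : mixed (fun z => (Q z).2.1) 0 1 z = 0 := hξ hz
  have m11 : mixed (fun z => (Q z).2.2) 1 1 z = 0 := m2 0
  have m21 : mixed (fun z => (Q z).2.2) 2 1 z = 0 := m2 1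
  have m31 : mixed (fun z => (Q z).2.2) 3 1 z = 0 := m2 2
  have m41 : mixed (fun z => (Q z).2.2) 4 1 z = 0 := m2 3
  have m02 : mixed (fun z => (Q z).2.2) 0 2 z = 0 := m1 0 0
  have m32 : mixed (fun z => (Q z).2.2) 3 2 z = 0 := m1 3 0
  have m23 : mixed (fun z => (Q z).2.2) 2 3 z = 0 := m1 2 1
  have m14 : mixed (fun z => (Q z).2.2) 1 4 z = 0 := m1 1 2
  have m05 : mixed (fun z => (Q z).2.2) 0 5 z = 0 := m1 0 3
  simp only [e1, e2, e3, e4, m11, m21, m31, m41, m02, m32, m23, m14, m05] at h1 h2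
  have h3 : pdt (fun z => (Q z).2.2) z + z.2.2 ^ n * pdx (fun z => (Q z).2.2) z
      + β z.1 * mixed (fun z => (Q z).2.2) 5 0 z = 0 := by linear_combination h1
  exact ⟨h3, by linear_combination h2 - h3⟩

end

/-! ### Splitting in powers of `u` and integration of the determining equations -/

lemma PowDefined.rpow_sub_ne_zero {n : ℝ} {S : Set ℝ} (h : PowDefined n S) {u : ℝ} (hu : u ∈ S)
    (hu0 : u ≠ 0) (k : ℤ) : u ^ (n - k) ≠ 0 := by
  -- At a negative base `Real.rpow` has a cosine factor that can vanish; for an integer exponent it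
  -- is `zpow`, which cannot.
  have hint (m : ℤ) (hm : n = m) : u ^ (n - k) ≠ 0 := by
    rw [hm, ← Int.cast_sub, Real.rpow_intCast]
    exact zpow_ne_zero _ hu0
  rcases h with h | ⟨⟨m, hm⟩, -⟩ | ⟨m, hm⟩
  · exact (Real.rpow_pos_of_pos (h hu) _).ne'
  · exact hint m hm
  · exact hint m (by exact_mod_cast hm)

lemma HasDerivAt.eq_zero_of_eventually {g : ℝ → ℝ} {g' a : ℝ} (h : HasDerivAt g g' a)
    (hg : ∀ᶠ s in nhds a, g s = 0) : g' = 0 :=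
  h.unique ((hasDerivAt_const a (0 : ℝ)).congr_of_eventuallyEq hg)

section
variable {n : ℝ} {D : Box} {β : ℝ → ℝ} {Q : VField}

lemma Box.eventually_mem {z : ℝ × ℝ × ℝ} (hz : z ∈ D.toSet) (v : ℝ × ℝ × ℝ) :
    ∀ᶠ s : ℝ in nhds 0, z + s • v ∈ D.toSet := by
  have : Continuous fun s : ℝ => z + s • v := by fun_prop
  exact this.continuousAt.eventually_mem (D.isOpen_toSet.mem_nhds (by simpa using hz))

/-- A smooth function on the box that vanishes wherever `u ≠ 0` is zero. -/
lemma Box.Smooth.eqOn_zero_of_ne {f : ℝ × ℝ × ℝ → ℝ} (hf : D.Smooth f)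
    (h : ∀ z ∈ D.toSet, z.2.2 ≠ 0 → f z = 0) : EqOn f 0 D.toSet := fun z hz => by
  have hc : ContinuousAt (fun s : ℝ => f (z + s • ((0, 0, 1) : ℝ × ℝ × ℝ))) 0 :=
    HasDerivAt.continuousAt (hf.hasLineDerivAt hz (0, 0, 1))
  have h1 := hc.tendsto.mono_left (nhdsWithin_le_nhds (s := {0}ᶜ))
  rcases eq_or_ne z.2.2 0 with h0 | h0
  swap
  · exact h z hz h0
  have ev : ∀ᶠ s : ℝ in nhdsWithin 0 {0}ᶜ, f (z + s • ((0, 0, 1) : ℝ × ℝ × ℝ)) = 0 := by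
    filter_upwards [nhdsWithin_le_nhds (Box.eventually_mem hz (0, 0, 1)),
      self_mem_nhdsWithin] with s hs hs0
    exact h _ hs (by simpa [h0] using hs0)
  have h2 := tendsto_nhds_unique h1 (tendsto_const_nhds.congr' (ev.mono fun s hs => hs.symm))
  simpa using h2

/-- Differentiating the second equation of `determining_rest` in `u` removes `ξ_t`; dividing by `n
u^(n-2)` and differentiating again isolates `τ_t - ξ_x + n η_u`. The difference of the two
consequences is `(n - 1)(η - u η_u) = 0`, which is where `n ≠ 1` enters. -/
lemma determining_split (hn : n ≠ 0) (hn1 : n ≠ 1) (hU : PowDefined n D.U)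
    (hβ : IsCoefficient D.J β) (hQ : Q ∈ maxAlgebra n D β) {z : ℝ × ℝ × ℝ} (hz : z ∈ D.toSet)
    (hz0 : z.2.2 ≠ 0) :
    pdt (fun z => (Q z).2.1) z = 0 ∧
    pdt (fun z => (Q z).1) z - pdx (fun z => (Q z).2.1) z + n * pdu (fun z => (Q z).2.2) z = 0 ∧
    (Q z).2.2 - z.2.2 * pdu (fun z => (Q z).2.2) z = 0 := by
  have hs := VField.smoothOn_of_contDiffOn hQ.1
  obtain ⟨hx, hu⟩ := determining_tau hn hU hβ hQ
  obtain ⟨hξ, -⟩ := determining_xi hn hU hβ hQ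
  obtain ⟨huu, hxu⟩ := determining_eta hn hU hβ hQ
  have hτtu (z) (hz : z ∈ D.toSet) : dirDeriv (0, 0, 1) (dirDeriv (1, 0, 0) fun z => (Q z).1) z = 0 :=
    (hs.tau.dirDeriv_comm _ _ hz).trans (dirDeriv_eq_zero hu _ hz)
  have hξtu (z) (hz : z ∈ D.toSet) :
      dirDeriv (0, 0, 1) (dirDeriv (1, 0, 0) fun z => (Q z).2.1) z = 0 :=
    (hs.xi.dirDeriv_comm _ _ hz).trans (dirDeriv_eq_zero hξ _ hz)
  have hξxu (z) (hz : z ∈ D.toSet) :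
      dirDeriv (0, 0, 1) (dirDeriv (0, 1, 0) fun z => (Q z).2.1) z = 0 :=
    (hs.xi.dirDeriv_comm _ _ hz).trans (dirDeriv_eq_zero hξ _ hz)
  have hηuu (z) (hz : z ∈ D.toSet) :
      dirDeriv (0, 0, 1) (dirDeriv (0, 0, 1) fun z => (Q z).2.2) z = 0 := huu hz
  have huv (z : ℝ × ℝ × ℝ) : HasDerivAt (fun s : ℝ => z.2.2 + s) 1 0 :=
    (hasDerivAt_id (0 : ℝ)).const_add _
  have hpow (z : ℝ × ℝ × ℝ) (hz0 : z.2.2 ≠ 0) (k : ℝ) :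
      HasDerivAt (fun s : ℝ => (z.2.2 + s) ^ k) (k * z.2.2 ^ (k - 1)) 0 := by
    have h := Real.hasDerivAt_rpow_const (x := z.2.2) (p := k) (.inl hz0)
    have := HasDerivAt.comp (0 : ℝ) (h₂ := fun x : ℝ => x ^ k) (by simpa using h) (huv z)
    rw [mul_one] at this
    exact this
  have first (z) (hz : z ∈ D.toSet) (hz0 : z.2.2 ≠ 0) :
      z.2.2 * (pdt (fun z => (Q z).1) z - pdx (fun z => (Q z).2.1) z) + (n - 1) * (Q z).2.2
        + z.2.2 * pdu (fun z => (Q z).2.2) z = 0 := by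
    have h1 := (hs.tau.dirDeriv (1, 0, 0)).hasLineDerivAt hz (0, 0, 1)
    have h2 := (hs.xi.dirDeriv (0, 1, 0)).hasLineDerivAt hz (0, 0, 1)
    have h3 := (hs.xi.dirDeriv (1, 0, 0)).hasLineDerivAt hz (0, 0, 1)
    have h4 := hs.eta.hasLineDerivAt hz (0, 0, 1)
    have h := ((((hpow z hz0 n).mul (HasDerivAt.sub h1 h2))).add
      (((hpow z hz0 (n - 1)).const_mul n).mul h4)).sub h3
    have h' := h.eq_zero_of_eventually ((Box.eventually_mem hz (0, 0, 1)).mono fun s hs => by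
      simpa using (determining_rest hn hU hβ hQ hs).2)
    simp only [hτtu z hz, hξtu z hz, hξxu z hz, zero_smul, add_zero, sub_zero, mul_zero] at h'
    have e : z.2.2 ^ (n - 1) = z.2.2 ^ (n - 2) * z.2.2 := by
      have h := Real.rpow_sub_one hz0 (n - 1)
      rw [show n - 1 - 1 = n - 2 by ring] at h
      rw [h]
      field_simp
    rw [show n - 1 - 1 = n - 2 by ring, e] at h'
    have hne : n * z.2.2 ^ (n - 2) ≠ 0 :=
      mul_ne_zero hn (by simpa using hU.rpow_sub_ne_zero hz.2.2 hz0 2)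
    refine (mul_eq_zero.1 ?_).resolve_left hne
    simp only [Pi.sub_apply, zero_smul, add_zero] at h'
    linear_combination h'
  have second : pdt (fun z => (Q z).1) z - pdx (fun z => (Q z).2.1) z
      + n * pdu (fun z => (Q z).2.2) z = 0 := by
    have h1 := (hs.tau.dirDeriv (1, 0, 0)).hasLineDerivAt hz (0, 0, 1)
    have h2 := (hs.xi.dirDeriv (0, 1, 0)).hasLineDerivAt hz (0, 0, 1)
    have h3 := (hs.eta.dirDeriv (0, 0, 1)).hasLineDerivAt hz (0, 0, 1)
    have h4 := hs.eta.hasLineDerivAt hz (0, 0, 1)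
    have h := (((huv z).mul (HasDerivAt.sub h1 h2)).add (HasDerivAt.const_mul (n - 1) h4)).add
      ((huv z).mul h3)
    have hne : ∀ᶠ s : ℝ in nhds 0, z.2.2 + s ≠ 0 :=
      (huv z).continuousAt.eventually_ne (by simpa using hz0)
    have h' := h.eq_zero_of_eventually (by
      filter_upwards [Box.eventually_mem hz (0, 0, 1), hne] with s hs hne
      simpa using first _ hs (by simpa using hne))
    simp only [hτtu z hz, hηuu z hz, hξxu z hz, zero_smul, add_zero, sub_zero, mul_zero,
      Pi.sub_apply] at h'
    linear_combination h'
  have third : (Q z).2.2 - z.2.2 * pdu (fun z => (Q z).2.2) z = 0 := by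
    refine (mul_eq_zero.1 ?_).resolve_left (sub_ne_zero.2 hn1)
    linear_combination first z hz hz0 - z.2.2 * second
  refine ⟨?_, second, third⟩
  have h := (determining_rest hn hU hβ hQ hz).2
  have e : z.2.2 ^ n = z.2.2 ^ (n - 1) * z.2.2 := by
    rw [Real.rpow_sub_one hz0]
    field_simp
  rw [e] at h
  linear_combination z.2.2 ^ (n - 1) * z.2.2 * second + n * z.2.2 ^ (n - 1) * third - h

lemma Box.smooth_snd_snd : D.Smooth fun z => z.2.2 := contDiff_snd.snd.contDiffOn

lemma Box.Smooth.exists_eq_add {f : ℝ × ℝ × ℝ → ℝ} (hf : D.Smooth f) {a b : ℝ}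
    (ht : ∀ z ∈ D.toSet, pdt f z = a) (hx : ∀ z ∈ D.toSet, pdx f z = b)
    (hu : ∀ z ∈ D.toSet, pdu f z = 0) : ∃ c, ∀ z ∈ D.toSet, f z = a * z.1 + b * z.2.1 + c := by
  let L : ℝ × ℝ × ℝ →L[ℝ] ℝ := a • ContinuousLinearMap.fst ℝ ℝ (ℝ × ℝ)
    + b • (ContinuousLinearMap.fst ℝ ℝ ℝ).comp (ContinuousLinearMap.snd ℝ ℝ (ℝ × ℝ))
  have hs : D.Smooth fun z => f z - L z := ContDiffOn.sub hf L.contDiff.contDiffOn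
  have e (v z : ℝ × ℝ × ℝ) (hz : z ∈ D.toSet) :
      _root_.dirDeriv v (fun z => f z - L z) z = _root_.dirDeriv v f z - L v := by
    have := (hf.differentiableAt hz).hasFDerivAt.sub L.hasFDerivAt
    have h2 : fderiv ℝ (fun z => f z - L z) z = fderiv ℝ f z - L := this.fderiv
    simp [_root_.dirDeriv, h2]
  obtain ⟨c, hc⟩ := hs.exists_eq_const
    (fun z hz => (e _ z hz).trans (by
      rw [show _root_.dirDeriv (1, 0, 0) f z = a from ht z hz]; simp [L]))
    (fun z hz => (e _ z hz).trans (by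
      rw [show _root_.dirDeriv (0, 1, 0) f z = b from hx z hz]; simp [L]))
    (fun z hz => (e _ z hz).trans (by
      rw [show _root_.dirDeriv (0, 0, 1) f z = 0 from hu z hz]; simp [L]))
  refine ⟨c, fun z hz => ?_⟩
  have := hc z hz
  simp only [L, add_apply, smul_apply,
    ContinuousLinearMap.comp_apply, ContinuousLinearMap.coe_fst', ContinuousLinearMap.coe_snd',
    smul_eq_mul] at this
  linear_combination this

/-- The split equations extend by continuity to `u = 0`. From `η = u η_u` and `η_xu = 0` follows
`η_x = 0`, then `η_t = 0`, so `η_u` is constant; `ξ_x` and `τ_t` are then constant too. -/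
lemma exists_components_of_mem_maxAlgebra (hn : n ≠ 0) (hn1 : n ≠ 1) (hU : PowDefined n D.U)
    (hβ : IsCoefficient D.J β) (hQ : Q ∈ maxAlgebra n D β) :
    ∃ a b c₁ c₀ e : ℝ, (∀ z ∈ D.toSet, Q z = (a * z.1 + b, c₁ * z.2.1 + c₀, e * z.2.2)) ∧
      a - c₁ + n * e = 0 ∧ ∀ t ∈ D.J, (a * t + b) * deriv β t = (5 * c₁ - a) * β t := by
  have hs := VField.smoothOn_of_contDiffOn hQ.1
  obtain ⟨hx, hu⟩ := determining_tau hn hU hβ hQ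
  obtain ⟨hξ, hξβ⟩ := determining_xi hn hU hβ hQ
  obtain ⟨huu, hxu⟩ := determining_eta hn hU hβ hQ
  have hξx := determining_xi_xx hn hU hβ hQ
  have hξt : EqOn (pdt fun z => (Q z).2.1) 0 D.toSet :=
    (hs.xi.dirDeriv _).eqOn_zero_of_ne fun z hz h0 =>
      (determining_split hn hn1 hU hβ hQ hz h0).1
  have hA : EqOn (fun z => pdt (fun z => (Q z).1) z - pdx (fun z => (Q z).2.1) z
      + n * pdu (fun z => (Q z).2.2) z) 0 D.toSet := by
    have : D.Smooth (fun z => pdt (fun z => (Q z).1) z - pdx (fun z => (Q z).2.1) z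
      + n * pdu (fun z => (Q z).2.2) z) :=
      ContDiffOn.add (ContDiffOn.sub (hs.tau.dirDeriv _) (hs.xi.dirDeriv _))
        (ContDiffOn.mul contDiffOn_const (hs.eta.dirDeriv _))
    exact this.eqOn_zero_of_ne fun z hz h0 => (determining_split hn hn1 hU hβ hQ hz h0).2.1
  have hη : EqOn (fun z => (Q z).2.2 - z.2.2 * pdu (fun z => (Q z).2.2) z) 0 D.toSet := by
    have : D.Smooth (fun z => (Q z).2.2 - z.2.2 * pdu (fun z => (Q z).2.2) z) :=
      ContDiffOn.sub hs.eta (ContDiffOn.mul Box.smooth_snd_snd (hs.eta.dirDeriv _))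
    exact this.eqOn_zero_of_ne fun z hz h0 => (determining_split hn hn1 hU hβ hQ hz h0).2.2
  -- directional derivatives of `η` along directions that leave `u` fixed
  have hηv (v : ℝ × ℝ × ℝ) (hv : v.2.2 = 0) (z) (hz : z ∈ D.toSet) :
      dirDeriv v (fun z => (Q z).2.2) z
        = z.2.2 * dirDeriv v (pdu fun z => (Q z).2.2) z := by
    have h1 := hs.eta.hasLineDerivAt hz v
    have h2 := HasDerivAt.const_mul z.2.2 ((hs.eta.dirDeriv (0, 0, 1)).hasLineDerivAt hz v)
    have h3 := (HasDerivAt.sub h1 h2).eq_zero_of_eventually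
      ((Box.eventually_mem hz v).mono fun s hs => by simpa [hv] using hη hs)
    exact sub_eq_zero.1 h3
  have hηx : EqOn (pdx fun z => (Q z).2.2) 0 D.toSet := fun z hz => by
    have h := hηv (0, 1, 0) rfl z hz
    rw [show dirDeriv (0, 1, 0) (pdu fun z => (Q z).2.2) z = 0 from hxu hz] at h
    simpa using h
  have hηt : EqOn (pdt fun z => (Q z).2.2) 0 D.toSet := fun z hz => by
    have h := (determining_rest hn hU hβ hQ hz).1
    rw [hηx hz, mixed_eq_zero_of_pdx hηx 4 hz] at h
    simpa using h
  obtain ⟨e, he⟩ := (hs.eta.dirDeriv (0, 0, 1)).exists_eq_const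
    (fun z hz => (hs.eta.dirDeriv_comm (1, 0, 0) (0, 0, 1) hz).trans (dirDeriv_eq_zero hηt _ hz))
    hxu huu
  obtain ⟨c₁, hc₁⟩ := (hs.xi.dirDeriv (0, 1, 0)).exists_eq_const
    (fun z hz => (hs.xi.dirDeriv_comm (1, 0, 0) (0, 1, 0) hz).trans (dirDeriv_eq_zero hξt _ hz))
    hξx (fun z hz => (hs.xi.dirDeriv_comm (0, 0, 1) (0, 1, 0) hz).trans (dirDeriv_eq_zero hξ _ hz))
  have ha (z) (hz : z ∈ D.toSet) : pdt (fun z => (Q z).1) z = c₁ - n * e := by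
    have h := hA hz
    simp only [Pi.zero_apply] at h
    rw [show pdx (fun z => (Q z).2.1) z = c₁ from hc₁ z hz,
      show pdu (fun z => (Q z).2.2) z = e from he z hz] at h
    linear_combination h
  obtain ⟨b, hb⟩ := hs.tau.exists_eq_add (b := 0) ha hx hu
  obtain ⟨c₀, hc₀⟩ := hs.xi.exists_eq_add (a := 0) hξt hc₁ hξ
  refine ⟨c₁ - n * e, b, c₁, c₀, e, fun z hz => ?_, by ring, fun t ht => ?_⟩
  · refine Prod.ext ?_ (Prod.ext ?_ ?_)
    · simpa using hb z hz
    · simpa using hc₀ z hz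
    · have h := hη hz
      simp only [Pi.zero_apply] at h
      rw [show pdu (fun z => (Q z).2.2) z = e from he z hz] at h
      dsimp only
      linear_combination h
  · obtain ⟨x, hx'⟩ := D.nonempty_X
    obtain ⟨u, hu'⟩ := D.nonempty_U
    have hz : (t, x, u) ∈ D.toSet := ⟨ht, hx', hu'⟩
    have h := hξβ _ hz
    rw [show pdx (fun z => (Q z).2.1) (t, x, u) = c₁ from hc₁ _ hz, ha _ hz] at h
    have h2 := hb _ hz
    simp only at h2 h
    rw [h2] at h
    linear_combination -h

/-! ### The converse -/

/-- Up to translations the field is an infinitesimal scaling with weights `a`, `c₁`, `e` of `t`,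
`x`, `u`, so `u_{i,j}` has weight `e - i a - j c₁`. -/
lemma prolongCoeff_of_affine {a b c₁ c₀ e : ℝ}
    (hQ : ∀ z ∈ D.toSet, Q z = (a * z.1 + b, c₁ * z.2.1 + c₀, e * z.2.2)) (i j : ℕ) :
    ∀ p : Jet, p.base ∈ D.toSet →
      Q.prolongCoeff i j p = (e - i * a - j * c₁) * p.2.2 (i, j) := by
  have line (c x y : ℝ) (d : ℝ) : HasDerivAt (fun s : ℝ => c * (x + s * y) + d) (c * y) 0 := by
    simpa using ((((hasDerivAt_id (0 : ℝ)).mul_const y).const_add x).const_mul c).add_const d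
  have htau (p q : Jet) (hp : p.base ∈ D.toSet) : lineDeriv ℝ Q.tau p q = a * q.1 :=
    (lineDeriv_congr_over (G := fun p => a * p.1 + b)
      (fun p hp => congrArg Prod.fst (hQ _ hp)) hp q).trans (line a p.1 q.1 b).deriv
  have hxi (p q : Jet) (hp : p.base ∈ D.toSet) : lineDeriv ℝ Q.xi p q = c₁ * q.2.1 :=
    (lineDeriv_congr_over (G := fun p => c₁ * p.2.1 + c₀)
      (fun p hp => congrArg (fun y => y.2.1) (hQ _ hp)) hp q).trans (line c₁ p.2.1 q.2.1 c₀).deriv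
  have hlin (F : Jet → ℝ) (c : ℝ) (i j : ℕ)
      (h : ∀ p : Jet, p.base ∈ D.toSet → F p = c * p.2.2 (i, j)) (p q : Jet)
      (hp : p.base ∈ D.toSet) : lineDeriv ℝ F p q = c * q.2.2 (i, j) :=
    (lineDeriv_congr_over (G := fun p => c * p.2.2 (i, j) + 0)
      (fun p hp => by simp [h p hp]) hp q).trans (line c (p.2.2 (i, j)) (q.2.2 (i, j)) 0).deriv
  have hT (i : ℕ) : ∀ p : Jet, p.base ∈ D.toSet →
      Q.prolongCoeffT i p = (e - i * a) * p.2.2 (i, 0) := by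
    induction i with
    | zero =>
      intro p hp
      rw [Nat.cast_zero, zero_mul, sub_zero]
      exact congrArg (fun y => y.2.2) (hQ _ hp)
    | succ i ih =>
      intro p hp
      simp only [VField.prolongCoeffT, totalDt]
      rw [hlin _ _ _ _ ih p _ hp, htau p _ hp, hxi p _ hp]
      push_cast
      ring
  induction j with
  | zero => intro p hp; simpa [VField.prolongCoeff] using hT i p hp
  | succ j ih =>
    intro p hp
    simp only [VField.prolongCoeff, totalDx]
    rw [hlin _ _ _ _ ih p _ hp, htau p _ hp, hxi p _ hp]
    push_cast
    ring

/-- The vector field `(a t + b) ∂_t + (c₁ x + c₀) ∂_x + e u ∂_u` on the box. -/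
def Box.affine (D : Box) (a b c₁ c₀ e : ℝ) : VField :=
  D.field fun t x u => (a * t + b, c₁ * x + c₀, e * u)

lemma Box.field_apply {f : ℝ → ℝ → ℝ → ℝ × ℝ × ℝ} {z : ℝ × ℝ × ℝ} (hz : z ∈ D.toSet) :
    D.field f z = f z.1 z.2.1 z.2.2 := indicator_of_mem hz _

lemma Box.field_of_notMem {f : ℝ → ℝ → ℝ → ℝ × ℝ × ℝ} {z : ℝ × ℝ × ℝ} (hz : z ∉ D.toSet) :
    D.field f z = 0 := indicator_of_notMem hz _

lemma affine_mem_maxAlgebra (hn : n ≠ 0) (hU : PowDefined n D.U)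
    (hβ : IsCoefficient D.J β) {a b c₁ e : ℝ} (c₀ : ℝ) (h₁ : a - c₁ + n * e = 0)
    (h₂ : ∀ t ∈ D.J, (a * t + b) * deriv β t = (5 * c₁ - a) * β t) :
    D.affine a b c₁ c₀ e ∈ maxAlgebra n D β := by
  have hQ : ∀ z ∈ D.toSet, D.affine a b c₁ c₀ e z = (a * z.1 + b, c₁ * z.2.1 + c₀, e * z.2.2) :=
    fun z hz => Box.field_apply hz
  refine ⟨?_, fun z hz => Box.field_of_notMem hz, fun p hp h0 => ?_⟩
  · refine ContDiffOn.congr (f := fun z => (a * z.1 + b, c₁ * z.2.1 + c₀, e * z.2.2)) ?_ hQ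
    fun_prop
  · rw [prolong_fkdv hn hU hβ hp, prolongCoeff_of_affine hQ 1 0 p hp,
      prolongCoeff_of_affine hQ 0 1 p hp, prolongCoeff_of_affine hQ 0 5 p hp, hQ _ hp]
    have h2 := h₂ p.1 hp.1
    have hpow : p.2.2 (0, 0) ^ (n - 1) * p.2.2 (0, 0) = p.2.2 (0, 0) ^ n := by
      rcases hU.ne_zero_or_one_le hn hp.2.2 with h | h
      · replace h : p.2.2 (0, 0) ≠ 0 := h
        rw [Real.rpow_sub_one h]
        field_simp
      · rcases eq_or_ne (p.2.2 (0, 0)) 0 with h' | h'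
        · rw [h', mul_zero, Real.zero_rpow hn]
        · rw [Real.rpow_sub_one h']
          field_simp
    simp only [fkdv] at h0
    simp only [Jet.base]
    push_cast
    -- All three terms of the equation have the same weight `e - a`: `h₁` adjusts `u^n u_x` and `h2`
    -- adjusts `β u_5`.
    linear_combination (e - a) * h0 + p.2.2 (0, 5) * h2 + n * e * p.2.2 (0, 1) * hpow
      + p.2.2 (0, 0) ^ n * p.2.2 (0, 1) * h₁

theorem mem_maxAlgebra_iff (hn : n ≠ 0) (hn1 : n ≠ 1) (hU : PowDefined n D.U)
    (hβ : IsCoefficient D.J β) : Q ∈ maxAlgebra n D β ↔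
    ∃ a b c₁ c₀ e : ℝ, Q = D.affine a b c₁ c₀ e ∧
      a - c₁ + n * e = 0 ∧ ∀ t ∈ D.J, (a * t + b) * deriv β t = (5 * c₁ - a) * β t := by
  constructor
  · intro hQ
    obtain ⟨a, b, c₁, c₀, e, h, h₁, h₂⟩ := exists_components_of_mem_maxAlgebra hn hn1 hU hβ hQ
    refine ⟨a, b, c₁, c₀, e, funext fun z => ?_, h₁, h₂⟩
    by_cases hz : z ∈ D.toSet
    · rw [h z hz, Box.affine, Box.field_apply hz]
    · rw [hQ.2.1 z hz, Box.affine, Box.field_of_notMem hz]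
  · rintro ⟨a, b, c₁, c₀, e, rfl, h₁, h₂⟩
    exact affine_mem_maxAlgebra hn hU hβ c₀ h₁ h₂

end

section
variable {n : ℝ} {D : Box} {β : ℝ → ℝ} {Q : VField}

/-! ### Linear algebra of affine vector fields -/

lemma exists_ne_mem_of_isOpen {S : Set ℝ} (hS : IsOpen S) (hne : S.Nonempty) (a : ℝ) :
    ∃ x ∈ S, x ≠ a := by
  obtain ⟨x, hx⟩ := hne
  obtain ⟨y, hy, h⟩ := (infinite_of_mem_nhds x (hS.mem_nhds hx)).nontrivial.exists_ne a
  exact ⟨y, hy, h⟩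

lemma affine_coeffs_eq_zero {S : Set ℝ} (hS : IsOpen S) (hne : S.Nonempty) {p q : ℝ}
    (h : ∀ t ∈ S, p * t + q = 0) : p = 0 ∧ q = 0 := by
  obtain ⟨x, hx⟩ := hne
  obtain ⟨y, hy, hxy⟩ := exists_ne_mem_of_isOpen hS ⟨x, hx⟩ x
  have hp : p = 0 := by
    refine (mul_eq_zero.1 ?_).resolve_right (sub_ne_zero.2 hxy)
    linear_combination h y hy - h x hx
  refine ⟨hp, ?_⟩
  simpa [hp] using h x hx

lemma Box.smul_affine_add (r a b c₁ c₀ e a' b' c₁' c₀' e' : ℝ) :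
    r • D.affine a b c₁ c₀ e + D.affine a' b' c₁' c₀' e'
      = D.affine (r * a + a') (r * b + b') (r * c₁ + c₁') (r * c₀ + c₀') (r * e + e') := by
  funext z
  by_cases hz : z ∈ D.toSet
  · simp only [Pi.add_apply, Pi.smul_apply, Box.affine, Box.field_apply hz, Prod.smul_mk,
      Prod.mk_add_mk, smul_eq_mul]
    congr 1
    · ring
    · congr 1 <;> ring
  · simp [Box.affine, Box.field_of_notMem hz]

lemma Box.affine_zero : D.affine 0 0 0 0 0 = 0 := by
  have h := D.smul_affine_add (-1) 0 0 0 0 0 0 0 0 0 0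
  simpa using h.symm

lemma Box.smul_affine (r a b c₁ c₀ e : ℝ) :
    r • D.affine a b c₁ c₀ e = D.affine (r * a) (r * b) (r * c₁) (r * c₀) (r * e) := by
  have h := D.smul_affine_add r a b c₁ c₀ e 0 0 0 0 0
  rw [Box.affine_zero] at h
  simpa using h

lemma Box.affine_add (a b c₁ c₀ e a' b' c₁' c₀' e' : ℝ) :
    D.affine a b c₁ c₀ e + D.affine a' b' c₁' c₀' e'
      = D.affine (a + a') (b + b') (c₁ + c₁') (c₀ + c₀') (e + e') := by
  simpa using D.smul_affine_add 1 a b c₁ c₀ e a' b' c₁' c₀' e'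

/-- An open interval contains two points, which determine an affine function, and `U` contains a
point `u ≠ 0`, which determines `e`. -/
lemma Box.affine_eq_zero {a b c₁ c₀ e : ℝ} (h : D.affine a b c₁ c₀ e = 0) :
    a = 0 ∧ b = 0 ∧ c₁ = 0 ∧ c₀ = 0 ∧ e = 0 := by
  have key (z) (hz : z ∈ D.toSet) : (a * z.1 + b, c₁ * z.2.1 + c₀, e * z.2.2) = (0 : ℝ × ℝ × ℝ) := by
    have h' := congrFun h z
    rwa [Box.affine, Box.field_apply hz] at h'
  obtain ⟨t, ht⟩ := D.nonempty_J
  obtain ⟨x, hx⟩ := D.nonempty_X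
  obtain ⟨u, hu, hu0⟩ := exists_ne_mem_of_isOpen D.isOpen_U D.nonempty_U 0
  obtain ⟨ha, hb⟩ := affine_coeffs_eq_zero D.isOpen_J D.nonempty_J fun t ht =>
    congrArg Prod.fst (key (t, x, u) ⟨ht, hx, hu⟩)
  obtain ⟨hc, hd⟩ := affine_coeffs_eq_zero D.isOpen_X D.nonempty_X fun x hx =>
    congrArg (fun y => y.2.1) (key (t, x, u) ⟨ht, hx, hu⟩)
  have he : e * u = 0 := congrArg (fun y => y.2.2) (key (t, x, u) ⟨ht, hx, hu⟩)
  exact ⟨ha, hb, hc, hd, (mul_eq_zero.1 he).resolve_right hu0⟩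

lemma Box.affine_inj {a b c₁ c₀ e a' b' c₁' c₀' e' : ℝ}
    (h : D.affine a b c₁ c₀ e = D.affine a' b' c₁' c₀' e') :
    a = a' ∧ b = b' ∧ c₁ = c₁' ∧ c₀ = c₀' ∧ e = e' := by
  have h' : D.affine (-1 * a' + a) (-1 * b' + b) (-1 * c₁' + c₁) (-1 * c₀' + c₀) (-1 * e' + e)
      = 0 := by
    rw [← Box.smul_affine_add, h]
    simp
  obtain ⟨h1, h2, h3, h4, h5⟩ := Box.affine_eq_zero h'
  refine ⟨?_, ?_, ?_, ?_, ?_⟩ <;> linarith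

/-! ### The kernel -/

lemma isCoefficient_const {ε : ℝ} (hε : ε ≠ 0) : IsCoefficient D.J fun _ => ε :=
  ⟨contDiffOn_const, fun _ _ => hε⟩

lemma isCoefficient_exp : IsCoefficient D.J Real.exp :=
  ⟨Real.contDiff_exp.contDiffOn, fun _ _ => (Real.exp_pos _).ne'⟩

/-- Two coefficients suffice: `β = 1` forces `5 c₁ = a`, and then `β = exp` forces `a t + b = 0` on
`J`. -/
theorem mem_kernelAlgebra_iff (hn : n ≠ 0) (hn1 : n ≠ 1) (hU : PowDefined n D.U) :
    Q ∈ kernelAlgebra n D ↔ ∃ c₀, Q = D.affine 0 0 0 c₀ 0 := by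
  constructor
  · intro h
    obtain ⟨a, b, c₁, c₀, e, rfl, h₁, h₂⟩ :=
      (mem_maxAlgebra_iff hn hn1 hU (isCoefficient_const one_ne_zero)).1
        (h _ (isCoefficient_const one_ne_zero))
    obtain ⟨a', b', c₁', c₀', e', h', h₁', h₂'⟩ :=
      (mem_maxAlgebra_iff hn hn1 hU isCoefficient_exp).1 (h _ isCoefficient_exp)
    obtain ⟨rfl, rfl, rfl, rfl, rfl⟩ := Box.affine_inj h'
    have e1 : 5 * c₁ - a = 0 := by
      obtain ⟨t, ht⟩ := D.nonempty_J
      simpa using (h₂ t ht).symm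
    obtain ⟨ha, hb⟩ := affine_coeffs_eq_zero D.isOpen_J D.nonempty_J (p := a) (q := b) fun t ht => by
      have := h₂' t ht
      rw [e1, zero_mul, Real.deriv_exp] at this
      exact (mul_eq_zero.1 this).resolve_right (Real.exp_pos t).ne'
    subst ha hb
    have hc : c₁ = 0 := by linarith
    subst hc
    have he : e = 0 := by simpa [hn] using h₁
    exact ⟨c₀, by rw [he]⟩
  · rintro ⟨c₀, rfl⟩ β hβ
    exact affine_mem_maxAlgebra hn hU hβ c₀ (by simp) (by simp)

lemma isBasisOf_kernelAlgebra (hn : n ≠ 0) (hn1 : n ≠ 1) (hU : PowDefined n D.U) :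
    IsBasisOf ![D.affine 0 0 0 1 0] (kernelAlgebra n D) := by
  constructor
  · rw [Fintype.linearIndependent_iff]
    intro g hg i
    simp only [Fin.sum_univ_one, Matrix.cons_val_zero, Box.smul_affine, mul_zero, mul_one] at hg
    rw [Fin.fin_one_eq_zero i]
    exact (Box.affine_eq_zero hg).2.2.2.1
  · ext Q
    rw [mem_kernelAlgebra_iff hn hn1 hU, SetLike.mem_coe, Submodule.mem_span_range_iff_exists_fun]
    simp only [Fin.sum_univ_one, Matrix.cons_val_zero, Box.smul_affine, mul_zero, mul_one]
    exact ⟨fun ⟨c, h⟩ => ⟨fun _ => c, h.symm⟩, fun ⟨c, h⟩ => ⟨c 0, h.symm⟩⟩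

/-! ### The bases of the maximal algebras -/

/-- Common to the power and exponential cases, where everything except the free `c₀` is proportional
to a single field. -/
lemma isBasisOf_pair {A : Set VField} {a b c₁ e : ℝ} (hab : a ≠ 0 ∨ b ≠ 0)
    (hA : ∀ Q, Q ∈ A ↔ ∃ r c₀, Q = D.affine (r * a) (r * b) (r * c₁) c₀ (r * e)) :
    IsBasisOf ![D.affine 0 0 0 1 0, D.affine a b c₁ 0 e] A := by
  constructor
  · rw [Fintype.linearIndependent_iff]
    intro g hg
    simp only [Fin.sum_univ_two, Matrix.cons_val_zero, Matrix.cons_val_one, Box.smul_affine,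
      Box.affine_add, mul_zero, mul_one, add_zero, zero_add] at hg
    obtain ⟨h1, h2, -, h4, -⟩ := Box.affine_eq_zero hg
    have h3 : g 1 = 0 := by
      rcases hab with h | h
      · exact (mul_eq_zero.1 h1).resolve_right h
      · exact (mul_eq_zero.1 h2).resolve_right h
    intro i
    fin_cases i
    · exact h4
    · exact h3
  · ext Q
    rw [hA, SetLike.mem_coe, Submodule.mem_span_range_iff_exists_fun]
    simp only [Fin.sum_univ_two, Matrix.cons_val_zero, Matrix.cons_val_one, Box.smul_affine,
      Box.affine_add, mul_zero, mul_one, add_zero, zero_add]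
    exact ⟨fun ⟨r, c, h⟩ => ⟨![c, r], h.symm⟩, fun ⟨g, h⟩ => ⟨g 1, g 0, h.symm⟩⟩

/-- Only `t β' = ρ β` matters, and it holds for either sign of `t`. It turns the condition on `β`
into `(a t + b) ρ = (5 c₁ - a) t`, so `b = 0` and `a ρ = 5 c₁ - a`. -/
lemma isBasisOf_power (hn : n ≠ 0) (hn1 : n ≠ 1) (hU : PowDefined n D.U)
    (hβ : IsCoefficient D.J β) {ε ρ : ℝ} (hρ : ρ ≠ 0)
    (h : ∀ t ∈ D.J, β t = ε * t ^ ρ) :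
    IsBasisOf ![D.affine 0 0 0 1 0, D.affine (5 * n) 0 ((ρ + 1) * n) 0 (ρ - 4)]
      (maxAlgebra n D β) := by
  have h0 (t) (ht : t ∈ D.J) : t ≠ 0 := by
    -- Since `0 ^ ρ = 0` for `ρ ≠ 0`, a nonvanishing `β` excludes `t = 0`.
    rintro rfl
    exact hβ.2 0 ht (by rw [h 0 ht, Real.zero_rpow hρ, mul_zero])
  have hd (t) (ht : t ∈ D.J) : t * deriv β t = ρ * β t := by
    have h1 := (Real.hasDerivAt_rpow_const (p := ρ) (.inl (h0 t ht))).const_mul ε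
    have h2 := h1.congr_of_eventuallyEq
      (Filter.eventuallyEq_of_mem (D.isOpen_J.mem_nhds ht) fun t ht => h t ht)
    rw [h2.deriv, h t ht, Real.rpow_sub_one (h0 t ht)]
    have := h0 t ht
    field_simp
  refine isBasisOf_pair (.inl (by simpa using hn)) fun Q => ?_
  rw [mem_maxAlgebra_iff hn hn1 hU hβ]
  constructor
  · rintro ⟨a, b, c₁, c₀, e, rfl, h₁, h₂⟩
    have key (t) (ht : t ∈ D.J) : (a * ρ - (5 * c₁ - a)) * t + b * ρ = 0 := by
      refine (mul_eq_zero.1 ?_).resolve_left (hβ.2 t ht)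
      linear_combination t * h₂ t ht - (a * t + b) * hd t ht
    obtain ⟨e1, e2⟩ := affine_coeffs_eq_zero D.isOpen_J D.nonempty_J key
    have hb : b = 0 := (mul_eq_zero.1 e2).resolve_right hρ
    -- The multiple is read off from the `∂_t` component.
    refine ⟨a / (5 * n), c₀, ?_⟩
    congr 1
    · field_simp
    · rw [hb, mul_zero]
    · field_simp
      linear_combination -e1
    · field_simp
      linear_combination 5 * h₁ - e1
  · rintro ⟨r, c₀, rfl⟩
    exact ⟨_, _, _, _, _, rfl, by ring, fun t ht => by linear_combination 5 * r * n * hd t ht⟩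

lemma isBasisOf_exponential (hn : n ≠ 0) (hn1 : n ≠ 1) (hU : PowDefined n D.U)
    (hβ : IsCoefficient D.J β) {ε : ℝ} (h : ∀ t ∈ D.J, β t = ε * Real.exp t) :
    IsBasisOf ![D.affine 0 0 0 1 0, D.affine 0 (5 * n) n 0 1] (maxAlgebra n D β) := by
  have hd (t) (ht : t ∈ D.J) : deriv β t = β t := by
    have h2 := ((Real.hasDerivAt_exp t).const_mul ε).congr_of_eventuallyEq
      (Filter.eventuallyEq_of_mem (D.isOpen_J.mem_nhds ht) fun t ht => h t ht)
    rw [h2.deriv, h t ht]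
  refine isBasisOf_pair (.inr (by simpa using hn)) fun Q => ?_
  rw [mem_maxAlgebra_iff hn hn1 hU hβ]
  constructor
  · rintro ⟨a, b, c₁, c₀, e, rfl, h₁, h₂⟩
    have key (t) (ht : t ∈ D.J) : a * t + (b - (5 * c₁ - a)) = 0 := by
      refine (mul_eq_zero.1 ?_).resolve_left (hβ.2 t ht)
      linear_combination h₂ t ht - (a * t + b) * hd t ht
    obtain ⟨rfl, e2⟩ := affine_coeffs_eq_zero D.isOpen_J D.nonempty_J key
    refine ⟨b / (5 * n), c₀, ?_⟩
    congr 1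
    · simp
    · field_simp
    · field_simp
      linear_combination -e2
    · field_simp
      linear_combination 5 * h₁ - e2
  · rintro ⟨r, c₀, rfl⟩
    exact ⟨_, _, _, _, _, rfl, by ring, fun t ht => by linear_combination 5 * r * n * hd t ht⟩

lemma isBasisOf_constant (hn : n ≠ 0) (hn1 : n ≠ 1) (hU : PowDefined n D.U)
    (hβ : IsCoefficient D.J β) {ε : ℝ} (h : ∀ t ∈ D.J, β t = ε) :
    IsBasisOf ![D.affine 0 0 0 1 0, D.affine 0 1 0 0 0, D.affine (5 * n) 0 n 0 (-4)]
      (maxAlgebra n D β) := by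
  have hd (t) (ht : t ∈ D.J) : deriv β t = 0 := by
    have h2 := (hasDerivAt_const t ε).congr_of_eventuallyEq
      (Filter.eventuallyEq_of_mem (D.isOpen_J.mem_nhds ht) fun t ht => h t ht)
    exact h2.deriv
  constructor
  · rw [Fintype.linearIndependent_iff]
    intro g hg
    simp only [Fin.sum_univ_three, Matrix.cons_val, Box.smul_affine,
      Box.affine_add, mul_zero, mul_one, add_zero, zero_add] at hg
    obtain ⟨h1, h2, -, h4, -⟩ := Box.affine_eq_zero hg
    intro i
    fin_cases i
    · exact h4
    · exact h2
    · simpa [hn] using h1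
  · ext Q
    rw [mem_maxAlgebra_iff hn hn1 hU hβ, SetLike.mem_coe, Submodule.mem_span_range_iff_exists_fun]
    simp only [Fin.sum_univ_three, Matrix.cons_val, Box.smul_affine,
      Box.affine_add, mul_zero, mul_one, add_zero, zero_add]
    constructor
    · rintro ⟨a, b, c₁, c₀, e, rfl, h₁, h₂⟩
      have e1 : 5 * c₁ - a = 0 := by
        obtain ⟨t, ht⟩ := D.nonempty_J
        have := h₂ t ht
        rw [hd t ht, mul_zero] at this
        exact (mul_eq_zero.1 this.symm).resolve_right (hβ.2 t ht)
      refine ⟨![c₀, b, a / (5 * n)], ?_⟩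
      simp only [Matrix.cons_val]
      congr 1
      · field_simp
      · field_simp
        linear_combination -e1
      · field_simp
        linear_combination -5 * h₁ - e1
    · rintro ⟨g, rfl⟩
      exact ⟨_, _, _, _, _, rfl, by ring, fun t ht => by rw [hd t ht]; ring⟩

/-! ### Extensions of the kernel -/

theorem maxAlgebra_ne_kernelAlgebra_iff (hn : n ≠ 0) (hn1 : n ≠ 1) (hU : PowDefined n D.U)
    (hβ : IsCoefficient D.J β) : maxAlgebra n D β ≠ kernelAlgebra n D ↔
      ∃ a b μ : ℝ, (a ≠ 0 ∨ b ≠ 0) ∧ ∀ t ∈ D.J, (a * t + b) * deriv β t = μ * β t := by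
  constructor
  · intro h
    by_contra! hcon
    refine h (Subset.antisymm (fun Q hQ => ?_) fun Q hQ => hQ β hβ)
    obtain ⟨a, b, c₁, c₀, e, rfl, h₁, h₂⟩ := (mem_maxAlgebra_iff hn hn1 hU hβ).1 hQ
    have hab : a = 0 ∧ b = 0 := by
      by_contra hab
      obtain ⟨t, ht, hne⟩ := hcon a b (5 * c₁ - a) (not_and_or.1 hab)
      exact hne (h₂ t ht)
    obtain ⟨rfl, rfl⟩ := hab
    obtain ⟨t, ht⟩ := D.nonempty_J
    have hc : c₁ = 0 := by simpa [hβ.2 t ht] using h₂ t ht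
    subst hc
    have he : e = 0 := by simpa [hn] using h₁
    exact (mem_kernelAlgebra_iff hn hn1 hU).2 ⟨c₀, by rw [he]⟩
  · rintro ⟨a, b, μ, hab, h⟩ heq
    -- The values of `c₁` and `e` solve `5 c₁ - a = μ` and `a - c₁ + n e = 0`.
    have hQ := affine_mem_maxAlgebra (e := ((μ + a) / 5 - a) / n) hn hU hβ (a := a) (b := b)
      (c₁ := (μ + a) / 5) 0 (by field_simp; ring) fun t ht => by rw [h t ht]; ring
    rw [heq] at hQ
    obtain ⟨c, hc⟩ := (mem_kernelAlgebra_iff hn hn1 hU).1 hQ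
    obtain ⟨rfl, rfl, -⟩ := Box.affine_inj hc
    simp at hab

end

section
variable {n : ℝ} {D D' : Box} {β β' : ℝ → ℝ}

/-! ### Canonical forms -/

/-- The logarithmic derivative of the profile of a canonical form. -/
def ExtCase.logDeriv : ExtCase → ℝ → ℝ
  | .power ρ, t => ρ / t
  | .exponential, _ => 1
  | .constant, _ => 0

/-- The conditions on the exponent and on the argument under which the profile is canonical. -/
def ExtCase.Admissible (c : ExtCase) (t : ℝ) : Prop := ∀ ρ, c = .power ρ → ρ ≠ 0 ∧ 0 < t

lemma ExtCase.Admissible.profile_pos {c : ExtCase} {t : ℝ} (h : c.Admissible t) :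
    0 < c.profile t := by
  match c with
  | .power ρ => exact Real.rpow_pos_of_pos (h ρ rfl).2 _
  | .exponential => exact Real.exp_pos t
  | .constant => exact one_pos

lemma ExtCase.Admissible.hasDerivAt {c : ExtCase} {t : ℝ} (h : c.Admissible t) :
    HasDerivAt c.profile (c.logDeriv t * c.profile t) t := by
  match c with
  | .power ρ =>
    have ht := (h ρ rfl).2.ne'
    have := Real.hasDerivAt_rpow_const (p := ρ) (.inl ht)
    rw [Real.rpow_sub_one ht] at this
    refine this.congr_deriv ?_
    simp only [logDeriv, profile]
    ring
  | .exponential => exact (Real.hasDerivAt_exp t).congr_deriv (one_mul _).symm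
  | .constant => exact (hasDerivAt_const t (1 : ℝ)).congr_deriv (zero_mul _).symm

lemma IsCanonical.admissible {c : ExtCase} {ε : ℝ} {J : Set ℝ} (h : IsCanonical c ε J β) {t : ℝ}
    (ht : t ∈ J) : c.Admissible t := fun ρ hρ => ⟨(h.2.1 ρ hρ).1, (h.2.1 ρ hρ).2 ht⟩

lemma EquivTransf.ne_zero (g : EquivTransf) : g.δ₁ ≠ 0 ∧ g.δ₃ ≠ 0 := mul_ne_zero_iff.1 g.pos.ne'

/-- Since `δ₁` and `δ₃` have the same sign, the sign of `β` is an invariant of the group; this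
separates `ε = 1` from `ε = -1`. -/
lemma EquivTransf.factor_pos (g : EquivTransf) : 0 < g.δ₁ ^ 5 / g.δ₃ := by
  obtain ⟨h1, h3⟩ := g.ne_zero
  have : g.δ₁ ^ 5 / g.δ₃ = g.δ₁ ^ 4 * (g.δ₁ * g.δ₃) / g.δ₃ ^ 2 := by field_simp
  rw [this]
  have := g.pos
  positivity

lemma EquivTransf.mem_of_image_eq {g : EquivTransf} (h : g.map n '' D.toSet = D'.toSet) {t : ℝ}
    (ht : t ∈ D.J) : g.δ₃ * t + g.δ₄ ∈ D'.J := by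
  obtain ⟨x, hx⟩ := D.nonempty_X
  obtain ⟨u, hu⟩ := D.nonempty_U
  have : g.map n (t, x, u) ∈ D'.toSet := h ▸ mem_image_of_mem _ ⟨ht, hx, hu⟩
  exact this.1

lemma hasDerivAt_profile_comp {c : ExtCase} {a b t : ℝ} (h : c.Admissible (a * t + b)) :
    HasDerivAt (fun t => c.profile (a * t + b))
      (a * c.logDeriv (a * t + b) * c.profile (a * t + b)) t := by
  have h1 : HasDerivAt (fun t : ℝ => a * t + b) a t := by
    simpa using ((hasDerivAt_id t).const_mul a).add_const b
  have := HasDerivAt.comp t (h₂ := c.profile) h.hasDerivAt h1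
  exact this.congr_deriv (by ring)

/-- Profiles are positive, so `ε` is the sign of `β`. Logarithmic derivatives lose the constant
factor and obey `δ₃ ℓ'(δ₃ t + δ₄) = ℓ(t)`; among `ρ / t`, `1` and `0` this preserves the type and
the exponent. -/
theorem canonical_unique {c c' : ExtCase} {ε ε' : ℝ} (h : IsCanonical c ε D.J β)
    (h' : IsCanonical c' ε' D'.J β') (he : Equivalent n D β D' β') : c = c' ∧ ε = ε' := by
  obtain ⟨g, hg, hβ⟩ := he
  have hK := g.factor_pos
  set K := g.δ₁ ^ 5 / g.δ₃
  obtain ⟨-, h3⟩ := g.ne_zero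
  have adm (t) (ht : t ∈ D.J) := h.admissible ht
  have adm' (t) (ht : t ∈ D.J) := h'.admissible (EquivTransf.mem_of_image_eq hg ht)
  have e (t) (ht : t ∈ D.J) : ε' * c'.profile (g.δ₃ * t + g.δ₄) = K * (ε * c.profile t) := by
    rw [← h.2.2 t ht, ← h'.2.2 _ (EquivTransf.mem_of_image_eq hg ht), hβ t ht]
  have hε : ε = ε' := by
    obtain ⟨t, ht⟩ := D.nonempty_J
    have h0 := e t ht
    have p := (adm t ht).profile_pos
    have p' := (adm' t ht).profile_pos
    have p'' := mul_pos hK p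
    rcases h.1 with rfl | rfl <;> rcases h'.1 with rfl | rfl
    · rfl
    · linarith
    · linarith
    · rfl
  refine ⟨?_, hε⟩
  have hε0 : ε' ≠ 0 := by rcases h'.1 with rfl | rfl <;> norm_num
  have key (t) (ht : t ∈ D.J) : g.δ₃ * c'.logDeriv (g.δ₃ * t + g.δ₄) = c.logDeriv t := by
    have h1 := (hasDerivAt_profile_comp (adm' t ht)).const_mul ε'
    have h2 := ((adm t ht).hasDerivAt.const_mul ε).const_mul K
    have h4 := h1.unique (h2.congr_of_eventuallyEq
      (Filter.eventuallyEq_of_mem (D.isOpen_J.mem_nhds ht) fun t ht => e t ht))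
    refine mul_right_cancel₀ (mul_ne_zero hε0 (adm' t ht).profile_pos.ne') ?_
    linear_combination h4 - c.logDeriv t * e t ht
  obtain ⟨t₀, ht₀⟩ := D.nonempty_J
  match c, c' with
  | .power ρ, .power ρ' =>
    congr 1
    -- Clearing denominators gives `δ₃ ρ' t = ρ (δ₃ t + δ₄)`, an identity of affine functions on an
    -- interval.
    have := affine_coeffs_eq_zero D.isOpen_J D.nonempty_J (p := g.δ₃ * (ρ' - ρ))
      (q := -(ρ * g.δ₄)) fun t ht => by
        have k := key t ht
        have p := (adm t ht ρ rfl).2.ne'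
        have p' := (adm' t ht ρ' rfl).2.ne'
        simp only [ExtCase.logDeriv] at k
        field_simp at k
        linear_combination k
    exact (sub_eq_zero.1 ((mul_eq_zero.1 this.1).resolve_left h3)).symm
  | .power ρ, .exponential =>
    have := affine_coeffs_eq_zero D.isOpen_J D.nonempty_J (p := g.δ₃) (q := -ρ) fun t ht => by
        have k := key t ht
        have p := (adm t ht ρ rfl).2.ne'
        simp only [ExtCase.logDeriv] at k
        field_simp at k
        linear_combination k
    exact absurd this.1 h3
  | .power ρ, .constant =>
    have k := key t₀ ht₀
    obtain ⟨p1, p2⟩ := adm t₀ ht₀ ρ rfl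
    simp only [ExtCase.logDeriv, mul_zero] at k
    exact absurd k.symm (div_ne_zero p1 p2.ne')
  | .exponential, .power ρ' =>
    have := affine_coeffs_eq_zero D.isOpen_J D.nonempty_J (p := g.δ₃) (q := g.δ₄ - g.δ₃ * ρ')
      fun t ht => by
        have k := key t ht
        have p' := (adm' t ht ρ' rfl).2.ne'
        simp only [ExtCase.logDeriv] at k
        field_simp at k
        linear_combination -k
    exact absurd this.1 h3
  | .exponential, .exponential => rfl
  | .exponential, .constant => simpa [ExtCase.logDeriv] using key t₀ ht₀
  | .constant, .power ρ' =>
    have k := key t₀ ht₀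
    obtain ⟨p1, p2⟩ := adm' t₀ ht₀ ρ' rfl
    simp [ExtCase.logDeriv, p1, p2.ne', h3] at k
  | .constant, .exponential =>
    have k := key t₀ ht₀
    simp [ExtCase.logDeriv, h3] at k
  | .constant, .constant => rfl

/-! ### Reduction to canonical forms -/

lemma isOpen_affine_image {S : Set ℝ} (hS : IsOpen S) {a : ℝ} (ha : a ≠ 0) (b : ℝ) :
    IsOpen ((fun x => a * x + b) '' S) := (affineHomeomorph a b ha).isOpenMap S hS

lemma ordConnected_affine_image {S : Set ℝ} (hS : S.OrdConnected) (a b : ℝ) :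
    ((fun x => a * x + b) '' S).OrdConnected :=
  (hS.isPreconnected.image _ (by fun_prop)).ordConnected

/-- The image of a box under a transformation of the equivalence group. -/
def EquivTransf.mapBox (g : EquivTransf) (n : ℝ) (D : Box) : Box where
  J := (fun t => g.δ₃ * t + g.δ₄) '' D.J
  X := (fun x => g.δ₁ * x + g.δ₂) '' D.X
  -- The summand `0` gives the scaling the affine form required by the image lemmas.
  U := (fun u => (g.δ₁ / g.δ₃) ^ (1 / n) * u + 0) '' D.U
  isOpen_J := isOpen_affine_image D.isOpen_J g.ne_zero.2 _
  isOpen_X := isOpen_affine_image D.isOpen_X g.ne_zero.1 _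
  isOpen_U := isOpen_affine_image D.isOpen_U (Real.rpow_pos_of_pos
    (div_pos_iff.2 (mul_pos_iff.1 g.pos)) _).ne' _
  nonempty_J := D.nonempty_J.image _
  nonempty_X := D.nonempty_X.image _
  nonempty_U := D.nonempty_U.image _
  ordConnected_J := ordConnected_affine_image D.ordConnected_J _ _
  ordConnected_X := ordConnected_affine_image D.ordConnected_X _ _
  ordConnected_U := ordConnected_affine_image D.ordConnected_U _ _

lemma EquivTransf.image_toSet (g : EquivTransf) : g.map n '' D.toSet = (g.mapBox n D).toSet := by
  simp only [Box.toSet, EquivTransf.mapBox, prod_image_image_eq, add_zero]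
  rfl

/-- This provides `δ₁ = d` for a given `δ₃ = a`: the sign of `a`, and modulus `(|a| / |C|)^(1/5)`,
so that the constant factor becomes `±1`. -/
lemma exists_scale {a C : ℝ} (ha : a ≠ 0) (hC : C ≠ 0) :
    ∃ d : ℝ, 0 < d * a ∧ (d ^ 5 / a * C = 1 ∨ d ^ 5 / a * C = -1) := by
  have hq : 0 < |a| / |C| := by positivity
  have hm : ((|a| / |C|) ^ (1 / 5 : ℝ)) ^ 5 = |a| / |C| := by
    rw [← Real.rpow_natCast, ← Real.rpow_mul hq.le]
    norm_num
  have hm0 := Real.rpow_pos_of_pos hq (1 / 5)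
  set m := (|a| / |C|) ^ (1 / 5 : ℝ)
  have habs (d : ℝ) (hd : |d| = m) : d ^ 5 / a * C = 1 ∨ d ^ 5 / a * C = -1 := by
    refine (abs_eq zero_le_one).1 ?_
    rw [abs_mul, abs_div, abs_pow, hd, hm]
    field_simp
  rcases lt_or_gt_of_ne ha with h | h
  · exact ⟨-m, mul_pos_of_neg_of_neg (neg_neg_of_pos hm0) h,
      habs _ (by rw [abs_neg, abs_of_pos hm0])⟩
  · exact ⟨m, mul_pos hm0 h, habs _ (abs_of_pos hm0)⟩

/-- The group acts on `t` by affine maps and rescales `β`. Any affine argument can thus become the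
new time, while `δ₁` normalizes the constant. -/
theorem exists_equivalent_canonical_iff (hβ : IsCoefficient D.J β) :
    (∃ (D' : Box) (β' : ℝ → ℝ) (c : ExtCase) (ε : ℝ),
      Equivalent n D β D' β' ∧ IsCanonical c ε D'.J β') ↔
    ∃ (a b C : ℝ) (c : ExtCase), a ≠ 0 ∧
      (∀ t ∈ D.J, c.Admissible (a * t + b)) ∧ ∀ t ∈ D.J, β t = C * c.profile (a * t + b) := by
  constructor
  · rintro ⟨D', β', c, ε, ⟨g, hg, he⟩, hc⟩
    have hmem (t) (ht : t ∈ D.J) := EquivTransf.mem_of_image_eq hg ht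
    refine ⟨g.δ₃, g.δ₄, (g.δ₁ ^ 5 / g.δ₃)⁻¹ * ε, c, g.ne_zero.2,
      fun t ht => hc.admissible (hmem t ht), fun t ht => ?_⟩
    rw [mul_assoc, ← hc.2.2 _ (hmem t ht), he t ht, inv_mul_cancel_left₀ g.factor_pos.ne']
  · rintro ⟨a, b, C, c, ha, hadm, h⟩
    obtain ⟨t₀, ht₀⟩ := D.nonempty_J
    have hC : C ≠ 0 := by
      rintro rfl
      exact hβ.2 t₀ ht₀ (by rw [h t₀ ht₀, zero_mul])
    obtain ⟨d, hd, hε⟩ := exists_scale ha hC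
    let g : EquivTransf := ⟨d, 0, a, b, hd⟩
    refine ⟨g.mapBox n D, fun s => d ^ 5 / a * β ((s - b) / a), c, d ^ 5 / a * C,
      ⟨g, g.image_toSet, fun t _ => ?_⟩, hε, fun ρ hρ => ⟨(hadm t₀ ht₀ ρ hρ).1, ?_⟩, ?_⟩
    · simp only [g]
      rw [add_sub_cancel_right, mul_div_cancel_left₀ _ ha]
    · rintro _ ⟨t, ht, rfl⟩
      exact (hadm t ht ρ hρ).2
    · rintro _ ⟨t, ht, rfl⟩
      simp only [g]
      rw [add_sub_cancel_right, mul_div_cancel_left₀ _ ha, h t ht, mul_assoc]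

lemma IsCoefficient.exists_eq_const_mul (hβ : IsCoefficient D.J β) {f f' : ℝ → ℝ}
    (hf : ∀ t ∈ D.J, HasDerivAt f (f' t) t) (hf0 : ∀ t ∈ D.J, f t ≠ 0)
    (h : ∀ t ∈ D.J, deriv β t * f t = β t * f' t) : ∃ C, ∀ t ∈ D.J, β t = C * f t := by
  have hd (t) (ht : t ∈ D.J) : HasDerivAt (fun t => β t / f t) 0 t := by
    have := (hβ.hasDerivAt ht).div (hf t ht) (hf0 t ht)
    rw [h t ht, sub_self, zero_div] at this
    exact this
  obtain ⟨C, hC⟩ := D.isOpen_J.exists_is_const_of_deriv_eq_zero D.ordConnected_J.isPreconnected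
    (fun t ht => (hd t ht).differentiableAt.differentiableWithinAt) fun t ht => (hd t ht).deriv
  exact ⟨C, fun t ht => by rw [← hC t ht, div_mul_cancel₀ _ (hf0 t ht)]⟩

lemma IsCoefficient.exists_profile (hβ : IsCoefficient D.J β) {c : ExtCase} {a b : ℝ}
    (hadm : ∀ t ∈ D.J, c.Admissible (a * t + b))
    (h : ∀ t ∈ D.J, deriv β t = a * c.logDeriv (a * t + b) * β t) :
    ∃ C, ∀ t ∈ D.J, β t = C * c.profile (a * t + b) :=
  hβ.exists_eq_const_mul (fun t ht => hasDerivAt_profile_comp (hadm t ht))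
    (fun t ht => (hadm t ht).profile_pos.ne') fun t ht => by rw [h t ht]; ring

/-- Needed when `(a t + b) β' = 0`, which says nothing at the zero of `a t + b`; continuity of `β'`
fills this point in. -/
lemma IsCoefficient.deriv_eq_zero_of_ne (hβ : IsCoefficient D.J β) {d : ℝ}
    (h : ∀ t ∈ D.J, t ≠ d → deriv β t = 0) : ∀ t ∈ D.J, deriv β t = 0 := by
  by_contra! hcon
  have hc : ContinuousOn (deriv β) D.J := hβ.1.continuousOn_deriv_of_isOpen D.isOpen_J (by simp)
  have ho : IsOpen (D.J ∩ deriv β ⁻¹' {0}ᶜ) :=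
    hc.isOpen_inter_preimage D.isOpen_J isOpen_compl_singleton
  obtain ⟨t, ht, hne⟩ := exists_ne_mem_of_isOpen ho hcon d
  exact ht.2 (h t ht.1 hne)

/-- Integration of `(a t + b) β' = μ β`: constants for `μ = 0`, exponentials with rate `μ / b` for
`a = 0`, and powers with exponent `μ / a` otherwise. -/
theorem exists_profile_iff (hβ : IsCoefficient D.J β) :
    (∃ (a b C : ℝ) (c : ExtCase), a ≠ 0 ∧
      (∀ t ∈ D.J, c.Admissible (a * t + b)) ∧ ∀ t ∈ D.J, β t = C * c.profile (a * t + b)) ↔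
    ∃ a b μ : ℝ, (a ≠ 0 ∨ b ≠ 0) ∧ ∀ t ∈ D.J, (a * t + b) * deriv β t = μ * β t := by
  constructor
  · rintro ⟨a, b, C, c, ha, hadm, h⟩
    have hd (t) (ht : t ∈ D.J) : deriv β t = a * c.logDeriv (a * t + b) * β t := by
      have h1 := ((hasDerivAt_profile_comp (hadm t ht)).const_mul C).congr_of_eventuallyEq
        (Filter.eventuallyEq_of_mem (D.isOpen_J.mem_nhds ht) fun t ht => h t ht)
      rw [h1.deriv, h t ht]
      ring
    match c with
    | .power ρ =>
      refine ⟨a, b, a * ρ, .inl ha, fun t ht => ?_⟩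
      have := (hadm t ht ρ rfl).2.ne'
      rw [hd t ht]
      simp only [ExtCase.logDeriv]
      field_simp
    | .exponential =>
      exact ⟨0, 1, a, .inr one_ne_zero, fun t ht => by rw [hd t ht]; simp [ExtCase.logDeriv]⟩
    | .constant =>
      exact ⟨0, 1, 0, .inr one_ne_zero, fun t ht => by rw [hd t ht]; simp [ExtCase.logDeriv]⟩
  · rintro ⟨a, b, μ, hab, h⟩
    have const (h0 : ∀ t ∈ D.J, deriv β t = 0) : ∃ (a b C : ℝ) (c : ExtCase), a ≠ 0 ∧
        (∀ t ∈ D.J, c.Admissible (a * t + b)) ∧ ∀ t ∈ D.J, β t = C * c.profile (a * t + b) := by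
      have hadm : ∀ t ∈ D.J, ExtCase.constant.Admissible (1 * t + 0) := fun t _ ρ hρ => by cases hρ
      obtain ⟨C, hC⟩ := hβ.exists_profile hadm fun t ht => by rw [h0 t ht]; simp [ExtCase.logDeriv]
      exact ⟨1, 0, C, _, one_ne_zero, hadm, hC⟩
    rcases eq_or_ne μ 0 with rfl | hμ
    · rcases eq_or_ne a 0 with rfl | ha
      · have hb : b ≠ 0 := by simpa using hab
        exact const fun t ht => by simpa [hb] using h t ht
      · refine const (hβ.deriv_eq_zero_of_ne (d := -b / a) fun t ht hne => ?_)
        have h1 := h t ht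
        rw [zero_mul] at h1
        refine (mul_eq_zero.1 h1).resolve_left fun h2 => hne ?_
        field_simp
        linear_combination h2
    rcases eq_or_ne a 0 with rfl | ha
    · have hb : b ≠ 0 := by simpa using hab
      have hadm : ∀ t ∈ D.J, ExtCase.exponential.Admissible (μ / b * t + 0) :=
        fun t _ ρ hρ => by cases hρ
      obtain ⟨C, hC⟩ := hβ.exists_profile hadm fun t ht => by
        have := h t ht
        simp only [ExtCase.logDeriv]
        field_simp
        linear_combination this
      exact ⟨μ / b, 0, C, _, div_ne_zero hμ hb, hadm, hC⟩
    -- A zero of `a t + b` in `J` would give `μ β = 0` there. Hence `a t + b` has constant sign on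
    -- the interval, and `σ = ±1` makes the base of the power positive without changing the
    -- logarithmic derivative.
    · have hne (t) (ht : t ∈ D.J) : a * t + b ≠ 0 := fun h0 => by
        have := h t ht
        rw [h0, zero_mul] at this
        exact mul_ne_zero hμ (hβ.2 t ht) this.symm
      have power (σ : ℝ) (hσ : σ ≠ 0) (hpos : ∀ t ∈ D.J, 0 < σ * a * t + σ * b) :
          ∃ (a b C : ℝ) (c : ExtCase), a ≠ 0 ∧
          (∀ t ∈ D.J, c.Admissible (a * t + b)) ∧ ∀ t ∈ D.J, β t = C * c.profile (a * t + b) := by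
        have hadm : ∀ t ∈ D.J, (ExtCase.power (μ / a)).Admissible (σ * a * t + σ * b) :=
          fun t ht ρ hρ => by
            cases hρ
            exact ⟨div_ne_zero hμ ha, hpos t ht⟩
        obtain ⟨C, hC⟩ := hβ.exists_profile hadm fun t ht => by
          have h1 := h t ht
          have h2 := hne t ht
          have h3 := (hpos t ht).ne'
          simp only [ExtCase.logDeriv]
          field_simp
          linear_combination h1
        exact ⟨σ * a, σ * b, C, _, mul_ne_zero hσ ha, hadm, hC⟩
      have him : ((fun t => a * t + b) '' D.J).OrdConnected :=
        ordConnected_affine_image D.ordConnected_J a b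
      obtain ⟨t₀, ht₀⟩ := D.nonempty_J
      have hzero : (0 : ℝ) ∉ (fun t => a * t + b) '' D.J := fun ⟨t, ht, h0⟩ => hne t ht h0
      rcases lt_or_gt_of_ne (hne t₀ ht₀) with h0 | h0
      · refine power (-1) (by norm_num) fun t ht => ?_
        by_contra! hcon
        exact hzero (him.out (mem_image_of_mem _ ht₀) (mem_image_of_mem _ ht)
          ⟨h0.le, show _ ≤ _ by linarith⟩)
      · refine power 1 one_ne_zero fun t ht => ?_
        by_contra! hcon
        exact hzero (him.out (mem_image_of_mem _ ht) (mem_image_of_mem _ ht₀)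
          ⟨show _ ≤ _ by linarith, h0.le⟩)

/-! ### Comparison with the basis fields -/

lemma Box.field_congr {f g : ℝ → ℝ → ℝ → ℝ × ℝ × ℝ} (h : ∀ t x u, f t x u = g t x u) :
    D.field f = D.field g := by
  have : f = g := funext fun t => funext fun x => funext fun u => h t x u
  rw [this]

lemma Box.field_dx : (D.field fun _ _ _ => (0, 1, 0)) = D.affine 0 0 0 1 0 :=
  Box.field_congr fun t x u => by simp

lemma Box.field_dt : (D.field fun _ _ _ => (1, 0, 0)) = D.affine 0 1 0 0 0 :=
  Box.field_congr fun t x u => by simp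

end

end

theorem theorem3 (n : ℝ) (hn0 : n ≠ 0) (hn1 : n ≠ 1) :
    -- the kernel is `⟨∂_x⟩`
    (∀ D : Box, PowDefined n D.U →
      IsBasisOf ![D.field fun _ _ _ => (0, 1, 0)] (kernelAlgebra n D)) ∧
    -- there is an extension of the kernel exactly when the equation is equivalent to a canonical one
    (∀ (D : Box) (β : ℝ → ℝ), PowDefined n D.U → IsCoefficient D.J β →
      (maxAlgebra n D β ≠ kernelAlgebra n D ↔
        ∃ (D' : Box) (β' : ℝ → ℝ) (c : ExtCase) (ε : ℝ),
          Equivalent n D β D' β' ∧ IsCanonical c ε D'.J β')) ∧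
    -- distinct canonical forms are inequivalent
    (∀ (D D' : Box) (β β' : ℝ → ℝ) (c c' : ExtCase) (ε ε' : ℝ),
      PowDefined n D.U → PowDefined n D'.U →
      IsCanonical c ε D.J β → IsCanonical c' ε' D'.J β' →
      Equivalent n D β D' β' → c = c' ∧ ε = ε') ∧
    -- the maximal Lie invariance algebra for `β = ε t ^ ρ`
    (∀ (D : Box) (β : ℝ → ℝ) (ε ρ : ℝ), PowDefined n D.U → IsCoefficient D.J β →
      ε ≠ 0 → ρ ≠ 0 → PowDefined ρ D.J → (∀ t ∈ D.J, β t = ε * t ^ ρ) →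
      IsBasisOf ![D.field fun _ _ _ => (0, 1, 0),
        D.field fun t x u => (5 * n * t, (ρ + 1) * n * x, (ρ - 4) * u)] (maxAlgebra n D β)) ∧
    -- the maximal Lie invariance algebra for `β = ε e ^ t`
    (∀ (D : Box) (β : ℝ → ℝ) (ε : ℝ), PowDefined n D.U → IsCoefficient D.J β →
      ε ≠ 0 → (∀ t ∈ D.J, β t = ε * Real.exp t) →
      IsBasisOf ![D.field fun _ _ _ => (0, 1, 0),
        D.field fun _ x u => (5 * n, n * x, u)] (maxAlgebra n D β)) ∧
    -- the maximal Lie invariance algebra for `β = ε`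
    (∀ (D : Box) (β : ℝ → ℝ) (ε : ℝ), PowDefined n D.U → IsCoefficient D.J β →
      ε ≠ 0 → (∀ t ∈ D.J, β t = ε) →
      IsBasisOf ![D.field fun _ _ _ => (0, 1, 0), D.field fun _ _ _ => (1, 0, 0),
        D.field fun t x u => (5 * n * t, n * x, -4 * u)] (maxAlgebra n D β)) := by
  refine ⟨fun D hU => ?_, fun D β hU hβ => ?_, fun D D' β β' c c' ε ε' _ _ h h' he =>
    canonical_unique h h' he, fun D β ε ρ hU hβ _ hρ _ h => ?_, fun D β ε hU hβ _ h => ?_,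
    fun D β ε hU hβ _ h => ?_⟩
  · rw [Box.field_dx]
    exact isBasisOf_kernelAlgebra hn0 hn1 hU
  · rw [maxAlgebra_ne_kernelAlgebra_iff hn0 hn1 hU hβ, exists_equivalent_canonical_iff hβ,
      exists_profile_iff hβ]
  · have e : (D.field fun t x u => (5 * n * t, (ρ + 1) * n * x, (ρ - 4) * u))
        = D.affine (5 * n) 0 ((ρ + 1) * n) 0 (ρ - 4) := Box.field_congr fun t x u => by simp
    rw [Box.field_dx, e]
    exact isBasisOf_power hn0 hn1 hU hβ hρ h
  · have e : (D.field fun _ x u => (5 * n, n * x, u)) = D.affine 0 (5 * n) n 0 1 :=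
      Box.field_congr fun t x u => by simp
    rw [Box.field_dx, e]
    exact isBasisOf_exponential hn0 hn1 hU hβ h
  · have e : (D.field fun t x u => (5 * n * t, n * x, -4 * u)) = D.affine (5 * n) 0 n 0 (-4) :=
      Box.field_congr fun t x u => by simp
    rw [Box.field_dx, Box.field_dt, e]
    exact isBasisOf_constant hn0 hn1 hU hβ h
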